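/- **Setting.** All manifolds, maps, forms and actions are smooth, and all manifolds and Lie groups are finite-dimensional. *Source.* Let $X$ be an oriented Riemannian four-manifold with a spin structure $Q\to X$, i.e. a principal bundle with group $Spin(4)=Sp_+(1)\times Sp_-(1)$ together with an equivariant bundle map $f\mapsto\tilde f$ to the bundle of oriented isometries $\tilde f\colon T_xX\to\mathbb H$, where $(q_+,q_-)$ acts on $\mathbb H$ by $y\mapsto q_+y\bar q_-$. Put $Q_+=Q/Sp_-(1)$, with the connection $\varphi$ induced by the Levi-Civita connection. A point $f\in Q_+$ over $x$ determines a quaternionic structure $(J_1,J_2,J_3)$ on $T_xX$ (left multiplication by $i,j,k$ in the frame), hence on the $\varphi$-horizontal subspace at $f$. *Target.* Let $\mathcal G$ be a Lie group whose Lie algebra $\mathcal L$ carries an $Ad$-invariant scalar product, let $\alpha\colon Sp(1)\to Aut(\mathcal G)$ be a smooth homomorphism, and let $\hat{\mathcal G}=\mathcal G\rtimes_\alpha Sp(1)$ act isometrically on a hyperKähler manifold $(M,g,I_1,I_2,I_3)$, with $\omega=\omega_1i+\omega_2j+\omega_3k$, such that * $\mathcal G$ acts tri-Hamiltonianly (in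 particular preserving $I_1,I_2,I_3$) with a $\mathcal G$-equivariant moment map $\mu\colon M\to\operatorname{Im}\mathbb H\otimes\mathcal L$, which is also $Sp(1)$-equivariant; * $Sp(1)$ acts permutingly: $L_q^*\omega=q\,\omega\,\bar q$ for $q\in Sp(1)$. Put $\mathbb M=Q_+\times_{Sp_+(1)}M$ and $\mathbb L=Q_+\times_{Sp_+(1)}\mathcal L$, and let $\nu\colon\mathbb M\to Q_+\times_{Sp_+(1)}(\operatorname{Im}\mathbb H\otimes\mathcal L)\cong\Lambda^2_+X\otimes\mathbb L$ be the bundle map induced by $\mu$. *Dirac operators.* A section $u$ of $\mathbb M$ corresponds to an equivariant map $\hat u$ on the principal $\hat{\mathcal G}$-bundle $\hat Q=\mathcal G\times Q_+$, and a form $b\in\Omega^1(X;\mathbb L)$ to the connection $B$ on $\hat Q$ whose pull-back to $Q_+$ is $b+\varphi$. The covariant derivative $\nabla^Bu$ is the restriction of the differential of $\hat u$ to the $B$-horizontal subspaces, and $D_bu$ is its pointwise $\mathbb H$-linear part, i.e. the projection of $A=\nabla^Bu$ along $\{A\mid I_1AJ_1+I_2AJ_2+I_3AJ_3=A\}$ to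 the space of $\mathbb H$-linear maps. For trivial $\mathcal G$ (and $b=0$) this gives the *pure* Dirac operator $D$, and a section $v$ with $Dv=0$ is a *pure harmonic spinor*. **Proposition.** Let $0\in\operatorname{Im}\mathbb H\otimes\mathcal L$ be a regular value of $\mu$, and let $\mathcal G$ act freely on $\mu^{-1}(0)$, so that (as is understood in the notion of the hyperKähler reduction) $\mu^{-1}(0)\to M_0=\mu^{-1}(0)/\mathcal G$ is a smooth principal $\mathcal G$-bundle; let $M_0$ carry the complex structures of the hyperKähler reduction and the induced action of $Sp(1)$, and put $\mathbb M_0=Q_+\times_{Sp_+(1)}M_0$. Let $u\in\Gamma(\mathbb M)$ satisfy $\nu\circ u=0$. Then $u$ projects to a unique smooth section $v\in\Gamma(\mathbb M_0)$, and $v$ is a pure harmonic spinor if and only if there exists $b\in\Omega^1(X;\mathbb L)$ such that $D_bu=0$. -/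

import Mathlib

open scoped Manifold ContDiff Quaternion Topology
open Bundle

noncomputable section

/-! ### Quaternions, `Sp(1)` and `Spin(4)` -/

/-- The group `Sp(1)` of unit quaternions (a 3-sphere). -/
abbrev Sp1 : Type := Metric.sphere (0 : ℍ[ℝ]) 1

instance factFinrankQuaternion : Fact (Module.finrank ℝ ℍ[ℝ] = 3 + 1) :=
  ⟨by simp [Quaternion.finrank_eq_four]⟩

/-- `Spin(4) = Sp₊(1) × Sp₋(1)`; the first factor is `Sp₊(1)`. -/
abbrev Spin4 : Type := Sp1 × Sp1

/-- The model with corners of the manifold `Spin(4) = S³ × S³`. -/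
abbrev modelSpin4 : ModelWithCorners ℝ
    (EuclideanSpace ℝ (Fin 3) × EuclideanSpace ℝ (Fin 3))
    (ModelProd (EuclideanSpace ℝ (Fin 3)) (EuclideanSpace ℝ (Fin 3))) :=
  (𝓡 3).prod (𝓡 3)

/-- The imaginary units `i, j, k`. -/
def imUnit : Fin 3 → ℍ[ℝ] := ![⟨0, 1, 0, 0⟩, ⟨0, 0, 1, 0⟩, ⟨0, 0, 0, 1⟩]

/-- The coefficients of a quaternion at `i, j, k`. -/
def imCoord (a : ℍ[ℝ]) : Fin 3 → ℝ := ![a.imI, a.imJ, a.imK]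

/-- The matrix of the rotation `a ↦ q a q̄` of `Im ℍ` in the basis `i, j, k`. -/
def imRot (q : Sp1) (k l : Fin 3) : ℝ := imCoord ((q : ℍ[ℝ]) * imUnit l * star (q : ℍ[ℝ])) k

lemma imUnit_re (l : Fin 3) : (imUnit l).re = 0 := by fin_cases l <;> rfl

lemma imUnit_imI (l : Fin 3) : (imUnit l).imI = if l = 0 then 1 else 0 := by fin_cases l <;> rfl

lemma imUnit_imJ (l : Fin 3) : (imUnit l).imJ = if l = 1 then 1 else 0 := by fin_cases l <;> rfl

lemma imUnit_imK (l : Fin 3) : (imUnit l).imK = if l = 2 then 1 else 0 := by fin_cases l <;> rfl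

lemma imRot_one (k l : Fin 3) : imRot 1 k l = if k = l then 1 else 0 := by
  fin_cases k <;> fin_cases l <;>
    simp [imRot, imCoord, imUnit_imI, imUnit_imJ, imUnit_imK]

lemma imRot_mul (p q : Sp1) (k l : Fin 3) :
    imRot (p * q) k l = ∑ j, imRot p k j * imRot q j l := by
  fin_cases k <;> fin_cases l <;>
    simp [imRot, imCoord, imUnit_re, imUnit_imI, imUnit_imJ, imUnit_imK,
      Fin.sum_univ_three] <;> ring

/-! ### Smooth principal bundles -/

section Principal

variable {EB : Type*} [NormedAddCommGroup EB] [NormedSpace ℝ EB]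
  {B : Type*} [TopologicalSpace B] [ChartedSpace EB B]
  {EP : Type*} [NormedAddCommGroup EP] [NormedSpace ℝ EP]
  {P : Type*} [TopologicalSpace P] [ChartedSpace EP P]
  {ES : Type*} [NormedAddCommGroup ES] [NormedSpace ℝ ES]
  {HS : Type*} [TopologicalSpace HS]
  {S : Type*} [TopologicalSpace S] [ChartedSpace HS S] [Group S]

/-- `proj : P → B` with the right action `r` of the Lie group `S` (modelled on `IS`) is a smooth
principal `S`-bundle: the action is smooth, free, preserves the fibres, and locally over `B` there
is a smooth section `σ` such that `(y, s) ↦ r (σ y) s` is a diffeomorphism onto the preimage, with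
smooth inverse `p ↦ (proj p, τ p)`. -/
structure IsPrincipalBundle (IS : ModelWithCorners ℝ ES HS) (proj : P → B) (r : P → S → P) :
    Prop where
  smooth_proj : ContMDiff 𝓘(ℝ, EP) 𝓘(ℝ, EB) ∞ proj
  smooth_act : ContMDiff (𝓘(ℝ, EP).prod IS) 𝓘(ℝ, EP) ∞ (fun p : P × S => r p.1 p.2)
  act_one : ∀ p, r p 1 = p
  act_mul : ∀ p s t, r p (s * t) = r (r p s) t
  proj_act : ∀ p s, proj (r p s) = proj p
  free : ∀ p s, r p s = p → s = 1
  locallyTrivial : ∀ x : B, ∃ U : Set B, IsOpen U ∧ x ∈ U ∧ ∃ (σ : B → P) (τ : P → S),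
    ContMDiffOn 𝓘(ℝ, EB) 𝓘(ℝ, EP) ∞ σ U ∧ (∀ y ∈ U, proj (σ y) = y) ∧
    ContMDiffOn 𝓘(ℝ, EP) IS ∞ τ (proj ⁻¹' U) ∧ ∀ p ∈ proj ⁻¹' U, r (σ (proj p)) (τ p) = p

end Principal

/-- The vector field `V` is smooth near the point `m`. -/
def IsSmoothFieldAt {E : Type*} [NormedAddCommGroup E] [NormedSpace ℝ E]
    {M : Type*} [TopologicalSpace M] [ChartedSpace E M] [IsManifold 𝓘(ℝ, E) ∞ M]
    (V : ∀ m : M, TangentSpace 𝓘(ℝ, E) m) (m : M) : Prop :=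
  ContMDiffAt 𝓘(ℝ, E) 𝓘(ℝ, E).tangent ∞ (fun m' => (⟨m', V m'⟩ : TangentBundle 𝓘(ℝ, E) M)) m

/-- The derivative at `m`, in the direction `v`, of a function on `M` with values in a normed
space. -/
def vecDeriv {E : Type*} [NormedAddCommGroup E] [NormedSpace ℝ E]
    {M : Type*} [TopologicalSpace M] [ChartedSpace E M]
    {V : Type*} [NormedAddCommGroup V] [NormedSpace ℝ V]
    (h : M → V) (m : M) (v : TangentSpace 𝓘(ℝ, E) m) : V :=
  mfderiv 𝓘(ℝ, E) 𝓘(ℝ, V) h m v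

/-! ### The source manifold: spin structures on oriented Riemannian four-manifolds -/

section Source

/-- The model space of the four-manifold. -/
abbrev E4 : Type := EuclideanSpace ℝ (Fin 4)

variable {X : Type*} [TopologicalSpace X] [ChartedSpace E4 X] [IsManifold 𝓘(ℝ, E4) ∞ X]

/-- A spin structure on `X` with Riemannian metric `g` and orientation `o`: a principal
`Spin(4)`-bundle `Q → X` with an equivariant smooth bundle map to the principal `SO(4)`-bundle of
oriented isometries `T_x X → ℍ`, where `(q₊, q₋)` acts on `ℍ` by `x ↦ q₊ x q̄₋`.
Smoothness of `f ↦ frame f` is expressed by smoothness of the tautological `ℍ`-valued 1-form.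
(Since `Q` has local sections, continuity of `o` is a consequence.) -/
structure SpinStructure
    (g : ContMDiffRiemannianMetric 𝓘(ℝ, E4) ∞ E4 (fun x : X => TangentSpace 𝓘(ℝ, E4) x))
    (o : ∀ x : X, Orientation ℝ (TangentSpace 𝓘(ℝ, E4) x) (Fin 4))
    (EQ : Type*) [NormedAddCommGroup EQ] [NormedSpace ℝ EQ]
    (Q : Type*) [TopologicalSpace Q] [ChartedSpace EQ Q] [IsManifold 𝓘(ℝ, EQ) ∞ Q] where
  /-- the bundle projection `Q → X` -/
  proj : Q → X
  /-- the right action of `Spin(4)` -/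
  r : Q → Spin4 → Q
  principal : IsPrincipalBundle (EB := E4) (EP := EQ) modelSpin4 proj r
  /-- the oriented isometry `T_x X → ℍ` underlying a spin frame over `x` -/
  frame : ∀ f : Q, TangentSpace 𝓘(ℝ, E4) (proj f) ≃L[ℝ] ℍ[ℝ]
  frame_isometry : ∀ f v, ‖frame f v‖ ^ 2 = g.inner (proj f) v v
  frame_oriented : ∀ f, Orientation.map (Fin 4) (frame f).toLinearEquiv (o (proj f)) =
    (QuaternionAlgebra.basisOneIJK (-1 : ℝ) 0 (-1)).orientation
  frame_act : ∀ (f : Q) (s : Spin4) (v : E4),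
    frame (r f s) v = star (s.1 : ℍ[ℝ]) * frame f v * (s.2 : ℍ[ℝ])
  smooth_frame : ContMDiff 𝓘(ℝ, EQ).tangent 𝓘(ℝ, ℍ[ℝ]) ∞
    (fun w : TangentBundle 𝓘(ℝ, EQ) Q => frame w.1 (mfderiv 𝓘(ℝ, EQ) 𝓘(ℝ, E4) proj w.1 w.2))

namespace SpinStructure

variable {g : ContMDiffRiemannianMetric 𝓘(ℝ, E4) ∞ E4 (fun x : X => TangentSpace 𝓘(ℝ, E4) x)}
  {o : ∀ x : X, Orientation ℝ (TangentSpace 𝓘(ℝ, E4) x) (Fin 4)}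
  {EQ : Type*} [NormedAddCommGroup EQ] [NormedSpace ℝ EQ]
  {Q : Type*} [TopologicalSpace Q] [ChartedSpace EQ Q] [IsManifold 𝓘(ℝ, EQ) ∞ Q]

/-- The quaternionic structure `(J₁, J₂, J₃)` on `T_x X` given by a frame `f` over `x`: left
multiplication by `i, j, k` in the frame (it depends only on the class of `f` in
`Q₊ = Q / Sp₋(1)`). -/
def J (P : SpinStructure g o EQ Q) (f : Q) (l : Fin 3) (v : TangentSpace 𝓘(ℝ, E4) (P.proj f)) :
    TangentSpace 𝓘(ℝ, E4) (P.proj f) :=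
  (P.frame f).symm (imUnit l * P.frame f v)

/-- The Levi-Civita connection `(φ, ψ)` on the principal `Spin(4)`-bundle `Q`: the connection
1-form with values in `sp₊(1) ⊕ sp₋(1) = Im ℍ ⊕ Im ℍ` that is torsion free, i.e.
`∇_V W - ∇_W V = [V, W]`, where in a frame `f` the vector `∇_V W` is the derivative of the
`ℍ`-valued function `f' ↦ frame f' (W (π f'))` along the horizontal lift of `V`. (It is metric since
`Q` is a bundle of orthonormal frames.) -/
structure LeviCivita (P : SpinStructure g o EQ Q) where
  /-- the `sp₊(1)`-component -/
  φ : ∀ f : Q, TangentSpace 𝓘(ℝ, EQ) f →L[ℝ] ℍ[ℝ]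
  /-- the `sp₋(1)`-component -/
  ψ : ∀ f : Q, TangentSpace 𝓘(ℝ, EQ) f →L[ℝ] ℍ[ℝ]
  im_φ : ∀ f w, (φ f w).re = 0
  im_ψ : ∀ f w, (ψ f w).re = 0
  smooth_φ : ContMDiff 𝓘(ℝ, EQ).tangent 𝓘(ℝ, ℍ[ℝ]) ∞
    (fun w : TangentBundle 𝓘(ℝ, EQ) Q => φ w.1 w.2)
  smooth_ψ : ContMDiff 𝓘(ℝ, EQ).tangent 𝓘(ℝ, ℍ[ℝ]) ∞
    (fun w : TangentBundle 𝓘(ℝ, EQ) Q => ψ w.1 w.2)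
  /-- the form reproduces the generators of the fundamental vector fields -/
  vertical_φ : ∀ (f : Q) (ζ : TangentSpace modelSpin4 (1 : Spin4)),
    φ f (mfderiv modelSpin4 𝓘(ℝ, EQ) (fun s : Spin4 => P.r f s) 1 ζ : EQ) =
      mfderiv modelSpin4 𝓘(ℝ, ℍ[ℝ]) (fun s : Spin4 => (s.1 : ℍ[ℝ])) 1 ζ
  vertical_ψ : ∀ (f : Q) (ζ : TangentSpace modelSpin4 (1 : Spin4)),
    ψ f (mfderiv modelSpin4 𝓘(ℝ, EQ) (fun s : Spin4 => P.r f s) 1 ζ : EQ) =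
      mfderiv modelSpin4 𝓘(ℝ, ℍ[ℝ]) (fun s : Spin4 => (s.2 : ℍ[ℝ])) 1 ζ
  equivariant_φ : ∀ (f : Q) (s : Spin4) (w : TangentSpace 𝓘(ℝ, EQ) f),
    φ (P.r f s) (mfderiv 𝓘(ℝ, EQ) 𝓘(ℝ, EQ) (fun f' => P.r f' s) f w) =
      star (s.1 : ℍ[ℝ]) * φ f w * (s.1 : ℍ[ℝ])
  equivariant_ψ : ∀ (f : Q) (s : Spin4) (w : TangentSpace 𝓘(ℝ, EQ) f),
    ψ (P.r f s) (mfderiv 𝓘(ℝ, EQ) 𝓘(ℝ, EQ) (fun f' => P.r f' s) f w) =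
      star (s.2 : ℍ[ℝ]) * ψ f w * (s.2 : ℍ[ℝ])
  torsion_free : ∀ (f : Q) (V W : ∀ x : X, TangentSpace 𝓘(ℝ, E4) x)
    (v w : TangentSpace 𝓘(ℝ, EQ) f),
    IsSmoothFieldAt V (P.proj f) → IsSmoothFieldAt W (P.proj f) →
    φ f v = 0 → ψ f v = 0 → mfderiv 𝓘(ℝ, EQ) 𝓘(ℝ, E4) P.proj f v = V (P.proj f) →
    φ f w = 0 → ψ f w = 0 → mfderiv 𝓘(ℝ, EQ) 𝓘(ℝ, E4) P.proj f w = W (P.proj f) →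
    vecDeriv (fun f' => P.frame f' (W (P.proj f'))) f v -
      vecDeriv (fun f' => P.frame f' (V (P.proj f'))) f w =
      P.frame f (VectorField.mlieBracket 𝓘(ℝ, E4) V W (P.proj f))

/-- The horizontal lift to `T_f Q` of a tangent vector of `X`: the unique vector over `v` that is
annihilated by the connection form. -/
def LeviCivita.lift {P : SpinStructure g o EQ Q} (A : P.LeviCivita) (f : Q)
    (v : TangentSpace 𝓘(ℝ, E4) (P.proj f)) : TangentSpace 𝓘(ℝ, EQ) f :=
  Classical.epsilon fun w => mfderiv 𝓘(ℝ, EQ) 𝓘(ℝ, E4) P.proj f w = v ∧ A.φ f w = 0 ∧ A.ψ f w = 0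

section Associated

variable {F : Type*}

/-- The identifications `(f, m) ∼ (f · s, s⁻¹ m)` defining the associated bundle; `Spin(4)` acts on
the fibre `F` through `Sp₊(1)`. -/
def assocSetoid (P : SpinStructure g o EQ Q) (act : Sp1 →* Equiv.Perm F) : Setoid (Q × F) where
  r a b := ∃ s : Spin4, b.1 = P.r a.1 s ∧ b.2 = act s.1⁻¹ a.2
  iseqv := by
    refine ⟨fun a => ⟨1, by simp [P.principal.act_one]⟩, ?_, ?_⟩
    · rintro a b ⟨s, h1, h2⟩
      refine ⟨s⁻¹, ?_, ?_⟩
      · rw [h1, ← P.principal.act_mul, mul_inv_cancel, P.principal.act_one]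
      · rw [h2, ← Equiv.Perm.mul_apply, ← map_mul]; simp
    · rintro a b c ⟨s, h1, h2⟩ ⟨t, h3, h4⟩
      refine ⟨s * t, ?_, ?_⟩
      · rw [h3, h1, P.principal.act_mul]
      · rw [h4, h2, ← Equiv.Perm.mul_apply, ← map_mul]; simp

/-- The total space of the associated bundle `Q₊ ×_{Sp₊(1)} F = Q ×_{Spin(4)} F` over `X`. -/
def Assoc (P : SpinStructure g o EQ Q) (act : Sp1 →* Equiv.Perm F) : Type _ :=
  Quotient (P.assocSetoid act)

/-- The class `[f, m]`. -/
def Assoc.mk (P : SpinStructure g o EQ Q) (act : Sp1 →* Equiv.Perm F) (f : Q) (m : F) :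
    P.Assoc act :=
  Quotient.mk (P.assocSetoid act) (f, m)

/-- The bundle projection of the associated bundle. -/
def Assoc.proj (P : SpinStructure g o EQ Q) (act : Sp1 →* Equiv.Perm F) : P.Assoc act → X :=
  Quotient.lift (fun a => P.proj a.1) (by
    rintro a b ⟨s, h1, -⟩
    rw [h1, P.principal.proj_act])

/-- The map of associated bundles `[f, m] ↦ [f, h m]` induced by an equivariant map `h`. -/
def Assoc.map (P : SpinStructure g o EQ Q) {F' : Type*} {act : Sp1 →* Equiv.Perm F}
    {act' : Sp1 →* Equiv.Perm F'} (h : F → F') (hh : ∀ q m, h (act q m) = act' q (h m)) :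
    P.Assoc act → P.Assoc act' :=
  Quotient.map (fun a => (a.1, h a.2)) (by
    rintro a b ⟨s, h1, h2⟩
    refine ⟨s, h1, ?_⟩
    change h b.2 = act' s.1⁻¹ (h a.2)
    rw [h2, hh])

/-- Smooth sections of the associated bundle with fibre the manifold `F`. A section is smooth if the
corresponding equivariant map `Q → F` is smooth. -/
structure Section (P : SpinStructure g o EQ Q) (EF : Type*) [NormedAddCommGroup EF]
    [NormedSpace ℝ EF] [TopologicalSpace F] [ChartedSpace EF F] (act : Sp1 →* Equiv.Perm F) where
  /-- the underlying map -/
  toFun : X → P.Assoc act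
  isSection : ∀ x, Assoc.proj P act (toFun x) = x
  smooth : ∃ h : Q → F, ContMDiff 𝓘(ℝ, EQ) 𝓘(ℝ, EF) ∞ h ∧
    ∀ f, toFun (P.proj f) = Assoc.mk P act f (h f)

/-- The (unique) equivariant map `û : Q → F` with `u(π(f)) = [f, û(f)]`. -/
def Section.equivariantMap {P : SpinStructure g o EQ Q} {EF : Type*} [NormedAddCommGroup EF]
    [NormedSpace ℝ EF] [TopologicalSpace F] [ChartedSpace EF F] {act : Sp1 →* Equiv.Perm F}
    (u : P.Section EF act) : Q → F :=
  Classical.choose u.smooth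

end Associated

/-- The projection `𝒞` of an `ℝ`-linear map `A : T_x X → T` to its `ℍ`-linear component, along the
complement `{A | I₁ A J₁ + I₂ A J₂ + I₃ A J₃ = A}`: it is `¼ (A - ∑ I_l A J_l)`. -/
def cliffordPart (P : SpinStructure g o EQ Q) (f : Q) {T : Type*} [AddCommGroup T] [Module ℝ T]
    (I : Fin 3 → T → T) (A : TangentSpace 𝓘(ℝ, E4) (P.proj f) → T) :
    TangentSpace 𝓘(ℝ, E4) (P.proj f) → T :=
  fun v => (4⁻¹ : ℝ) • (A v - ∑ l, I l (A (P.J f l v)))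

/-- The pure Dirac operator (trivial group `𝒢`): `ℍ`-linear part of the covariant derivative
`∇^φ u`, which is the restriction of the differential of the equivariant map to horizontal vectors.
The value is given in the frame `f`. Here `I` is the triple of complex structures of the target. -/
def pureDirac {P : SpinStructure g o EQ Q} (A : P.LeviCivita) {F EF : Type*} [NormedAddCommGroup EF]
    [NormedSpace ℝ EF] [TopologicalSpace F] [ChartedSpace EF F] {act : Sp1 →* Equiv.Perm F}
    (I : Fin 3 → ∀ y : F, TangentSpace 𝓘(ℝ, EF) y →L[ℝ] TangentSpace 𝓘(ℝ, EF) y)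
    (u : P.Section EF act) (f : Q) (v : TangentSpace 𝓘(ℝ, E4) (P.proj f)) :
    TangentSpace 𝓘(ℝ, EF) (u.equivariantMap f) :=
  P.cliffordPart f (fun l => I l (u.equivariantMap f))
    (fun v => mfderiv 𝓘(ℝ, EQ) 𝓘(ℝ, EF) u.equivariantMap f (A.lift f v)) v

end SpinStructure

end Source

/-! ### The group `𝒢` with its `Sp(1)`-action -/

section Target

variable {EG : Type*} [NormedAddCommGroup EG] [NormedSpace ℝ EG]
  {G : Type*} [TopologicalSpace G] [ChartedSpace EG G] [Group G]
  {EM : Type*} [NormedAddCommGroup EM] [NormedSpace ℝ EM]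
  {M : Type*} [TopologicalSpace M] [ChartedSpace EM M] [IsManifold 𝓘(ℝ, EM) ∞ M]

/-- The adjoint action of the Lie group `G` on its Lie algebra `T_1 G`. (As a vector space the
Lie algebra is the model space `EG`.) -/
def lieAd (g : G) : EG →L[ℝ] EG := mfderiv 𝓘(ℝ, EG) 𝓘(ℝ, EG) (fun h : G => g * h * g⁻¹) 1

/-- The Killing vector `K_ξ` at `m` of an action of `G` on `M`: the derivative of `a ↦ a m` at
`a = 1` in the direction `ξ`. -/
def killingField (act : G →* Equiv.Perm M) (m : M) (ξ : EG) : TangentSpace 𝓘(ℝ, EM) m :=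
  (mfderiv 𝓘(ℝ, EG) 𝓘(ℝ, EM) (fun a : G => act a m) 1 ξ : EM)

variable (EG G) in
/-- A smooth action of `Sp(1)` on the Lie group `𝒢 = G` by automorphisms, and an `Ad`-invariant
scalar product on the Lie algebra `ℒ`. -/
structure SymmetryData where
  /-- the homomorphism `α : Sp(1) → Aut 𝒢` -/
  α : Sp1 →* MulAut G
  smooth_α : ContMDiff ((𝓡 3).prod 𝓘(ℝ, EG)) 𝓘(ℝ, EG) ∞ (fun p : Sp1 × G => α p.1 p.2)
  /-- the scalar product on the Lie algebra -/
  κ : EG →L[ℝ] EG →L[ℝ] ℝ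
  κ_symm : ∀ ξ η, κ ξ η = κ η ξ
  κ_pos : ∀ ξ, ξ ≠ 0 → 0 < κ ξ ξ
  κ_ad : ∀ (g : G) ξ η, κ (lieAd g ξ) (lieAd g η) = κ ξ η

namespace SymmetryData

variable (Γ : SymmetryData EG G)

/-- The extended group `𝒢 ⋊ Sp(1)`. -/
abbrev Hat : Type _ := G ⋊[Γ.α] Sp1

/-- The action of `Sp(1)` on the Lie algebra `ℒ` of `𝒢`: the differential of `α q` at `1`. -/
def dα (q : Sp1) : EG →L[ℝ] EG := mfderiv 𝓘(ℝ, EG) 𝓘(ℝ, EG) (fun h : G => Γ.α q h) 1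

lemma dα_one : Γ.dα 1 = ContinuousLinearMap.id ℝ EG := by
  have : (fun h : G => Γ.α 1 h) = id := by ext; simp
  unfold dα
  rw [this]
  exact mfderiv_id

lemma mdifferentiable_α (q : Sp1) :
    MDifferentiable 𝓘(ℝ, EG) 𝓘(ℝ, EG) (fun h : G => Γ.α q h) := by
  have h : ContMDiff 𝓘(ℝ, EG) 𝓘(ℝ, EG) ∞ (fun h : G => Γ.α q h) :=
    Γ.smooth_α.comp (contMDiff_const.prodMk contMDiff_id)
  exact h.mdifferentiable (by simp)

lemma hasMFDerivAt_α (q : Sp1) (y : G) (hy : y = 1) :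
    HasMFDerivAt 𝓘(ℝ, EG) 𝓘(ℝ, EG) (fun h : G => Γ.α q h) y (Γ.dα q) := by
  subst hy
  exact (Γ.mdifferentiable_α q 1).hasMFDerivAt

lemma dα_mul (p q : Sp1) : Γ.dα (p * q) = (Γ.dα p).comp (Γ.dα q) := by
  have h1 := (Γ.hasMFDerivAt_α p (Γ.α q 1) (map_one _)).comp (1 : G) (Γ.hasMFDerivAt_α q 1 rfl)
  have h2 : (fun h : G => Γ.α p h) ∘ (fun h : G => Γ.α q h) = fun h : G => Γ.α (p * q) h := by
    ext; simp
  rw [h2] at h1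
  exact h1.mfderiv

/-- The action of `q` on `Im ℍ ⊗ ℒ`, by `a ⊗ ξ ↦ q a q̄ ⊗ q ξ`. An element `∑ e_l ⊗ x_l`
(`e = i, j, k`) of `Im ℍ ⊗ ℒ` is represented by its components `x : Fin 3 → ℒ`. -/
def imActFun (q : Sp1) (x : Fin 3 → EG) : Fin 3 → EG :=
  fun k => ∑ l, imRot q k l • Γ.dα q (x l)

lemma imActFun_one (x : Fin 3 → EG) : Γ.imActFun 1 x = x := by
  ext k; simp [imActFun, imRot_one, dα_one]

lemma imActFun_mul (p q : Sp1) (x : Fin 3 → EG) :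
    Γ.imActFun (p * q) x = Γ.imActFun p (Γ.imActFun q x) := by
  ext k
  simp only [imActFun, imRot_mul, dα_mul, map_sum, map_smul, Finset.sum_smul, Finset.smul_sum,
    ContinuousLinearMap.comp_apply, smul_smul]
  exact Finset.sum_comm

lemma imActFun_zero (q : Sp1) : Γ.imActFun q 0 = 0 := by
  ext k; simp [imActFun]

/-- The representation of `Sp(1)` on `Im ℍ ⊗ ℒ`. -/
def imAct : Sp1 →* Equiv.Perm (Fin 3 → EG) where
  toFun q :=
    { toFun := Γ.imActFun q
      invFun := Γ.imActFun q⁻¹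
      left_inv := fun x => by rw [← imActFun_mul, inv_mul_cancel, imActFun_one]
      right_inv := fun x => by rw [← imActFun_mul, mul_inv_cancel, imActFun_one] }
  map_one' := by ext x : 1; exact Γ.imActFun_one x
  map_mul' p q := by ext x : 1; exact Γ.imActFun_mul p q x

end SymmetryData

/-! ### HyperKähler manifolds -/

variable (EM M) in
/-- A hyperKähler structure on `M`: a Riemannian metric that is Kähler with respect to three complex
structures `I 0, I 1, I 2` satisfying the quaternionic relations. -/
structure HyperKahler where
  /-- the Riemannian metric -/
  g : ContMDiffRiemannianMetric 𝓘(ℝ, EM) ∞ EM (fun m : M => TangentSpace 𝓘(ℝ, EM) m)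
  /-- the complex structures -/
  I : Fin 3 → ∀ m : M, TangentSpace 𝓘(ℝ, EM) m →L[ℝ] TangentSpace 𝓘(ℝ, EM) m
  smooth_I : ∀ l, ContMDiff 𝓘(ℝ, EM).tangent 𝓘(ℝ, EM).tangent ∞
    (fun v : TangentBundle 𝓘(ℝ, EM) M => (⟨v.1, I l v.1 v.2⟩ : TangentBundle 𝓘(ℝ, EM) M))
  I_sq : ∀ l m v, I l m (I l m v) = -v
  I_mul : ∀ m v, I 0 m (I 1 m v) = I 2 m v
  orthogonal : ∀ l m v w, g.inner m (I l m v) (I l m w) = g.inner m v w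
  /-- the Nijenhuis tensors vanish -/
  integrable : ∀ (l : Fin 3) (m : M) (V W : ∀ m : M, TangentSpace 𝓘(ℝ, EM) m),
    IsSmoothFieldAt V m → IsSmoothFieldAt W m →
    VectorField.mlieBracket 𝓘(ℝ, EM) V W m
      + I l m (VectorField.mlieBracket 𝓘(ℝ, EM) (fun m' => I l m' (V m')) W m)
      + I l m (VectorField.mlieBracket 𝓘(ℝ, EM) V (fun m' => I l m' (W m')) m)
      - VectorField.mlieBracket 𝓘(ℝ, EM) (fun m' => I l m' (V m')) (fun m' => I l m' (W m')) m = 0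
  /-- the Kähler forms `g (I l ·, ·)` are closed -/
  closed : ∀ (l : Fin 3) (m : M) (U V W : ∀ m : M, TangentSpace 𝓘(ℝ, EM) m),
    IsSmoothFieldAt U m → IsSmoothFieldAt V m → IsSmoothFieldAt W m →
    vecDeriv (fun m' => g.inner m' (I l m' (V m')) (W m')) m (U m)
      - vecDeriv (fun m' => g.inner m' (I l m' (U m')) (W m')) m (V m)
      + vecDeriv (fun m' => g.inner m' (I l m' (U m')) (V m')) m (W m)
      - g.inner m (I l m (VectorField.mlieBracket 𝓘(ℝ, EM) U V m)) (W m)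
      + g.inner m (I l m (VectorField.mlieBracket 𝓘(ℝ, EM) U W m)) (V m)
      - g.inner m (I l m (VectorField.mlieBracket 𝓘(ℝ, EM) V W m)) (U m) = 0

/-- The `Im ℍ`-valued 2-form `ω₁ i + ω₂ j + ω₃ k`, where `ω_l = g (I l ·, ·)`. -/
def HyperKahler.ω (K : HyperKahler EM M) (m : M) (v w : TangentSpace 𝓘(ℝ, EM) m) : ℍ[ℝ] :=
  ⟨0, K.g.inner m (K.I 0 m v) w, K.g.inner m (K.I 1 m v) w, K.g.inner m (K.I 2 m v) w⟩

variable (EM M) in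
/-- The target: a hyperKähler manifold `M` with a smooth isometric action of `𝒢 ⋊ Sp(1)` such that
`𝒢` acts tri-Hamiltonianly with moment map `μ : M → Im ℍ ⊗ ℒ`, which is also `Sp(1)`-equivariant,
and the action of `Sp(1)` is permuting, `L_q^* ω = q ω q̄`. -/
structure Target (Γ : SymmetryData EG G) where
  /-- the hyperKähler structure -/
  hk : HyperKahler EM M
  /-- the action of `𝒢 ⋊ Sp(1)` -/
  act : Γ.Hat →* Equiv.Perm M
  smooth_act : ContMDiff (𝓘(ℝ, EG).prod ((𝓡 3).prod 𝓘(ℝ, EM))) 𝓘(ℝ, EM) ∞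
    (fun p : G × Sp1 × M => act ⟨p.1, p.2.1⟩ p.2.2)
  isometric : ∀ (a : Γ.Hat) (m : M) (v w : TangentSpace 𝓘(ℝ, EM) m),
    hk.g.inner (act a m) (mfderiv 𝓘(ℝ, EM) 𝓘(ℝ, EM) (act a) m v)
      (mfderiv 𝓘(ℝ, EM) 𝓘(ℝ, EM) (act a) m w) = hk.g.inner m v w
  preserves_I : ∀ (a : G) (l : Fin 3) (m : M) (v : TangentSpace 𝓘(ℝ, EM) m),
    mfderiv 𝓘(ℝ, EM) 𝓘(ℝ, EM) (act (SemidirectProduct.inl a)) m (hk.I l m v) =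
      hk.I l (act (SemidirectProduct.inl a) m)
        (mfderiv 𝓘(ℝ, EM) 𝓘(ℝ, EM) (act (SemidirectProduct.inl a)) m v)
  permuting : ∀ (q : Sp1) (m : M) (v w : TangentSpace 𝓘(ℝ, EM) m),
    hk.ω (act (SemidirectProduct.inr q) m)
      (mfderiv 𝓘(ℝ, EM) 𝓘(ℝ, EM) (act (SemidirectProduct.inr q)) m v)
      (mfderiv 𝓘(ℝ, EM) 𝓘(ℝ, EM) (act (SemidirectProduct.inr q)) m w) =
      (q : ℍ[ℝ]) * hk.ω m v w * star (q : ℍ[ℝ])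
  /-- the moment map, by its components along `i, j, k` -/
  μ : M → Fin 3 → EG
  smooth_μ : ContMDiff 𝓘(ℝ, EM) 𝓘(ℝ, Fin 3 → EG) ∞ μ
  /-- `d⟨μ_l, ξ⟩ = ω_l (K_ξ, ·)`, where `K_ξ` is the Killing field of `ξ` -/
  moment : ∀ (l : Fin 3) (m : M) (v : TangentSpace 𝓘(ℝ, EM) m) (ξ : EG),
    Γ.κ (vecDeriv μ m v l) ξ =
      hk.g.inner m (hk.I l m (killingField (act.comp SemidirectProduct.inl) m ξ)) v
  μ_equivariant : ∀ (a : G) (m : M) (l : Fin 3),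
    μ (act (SemidirectProduct.inl a) m) l = lieAd a (μ m l)
  μ_permuting : ∀ (q : Sp1) (m : M), μ (act (SemidirectProduct.inr q) m) = Γ.imAct q (μ m)

namespace Target

variable {Γ : SymmetryData EG G} (T : Target EM M Γ)

/-- The action of `𝒢` on `M`. -/
def actG : G →* Equiv.Perm M := T.act.comp SemidirectProduct.inl

/-- The action of `Sp(1)` on `M`. -/
def actSp : Sp1 →* Equiv.Perm M := T.act.comp SemidirectProduct.inr

/-- The Killing field `K_ξ` at `m`. -/
def killing (m : M) (ξ : EG) : TangentSpace 𝓘(ℝ, EM) m :=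
  killingField T.actG m ξ

/-- `0` is a regular value of the moment map. -/
def ZeroIsRegularValue : Prop :=
  ∀ m, T.μ m = 0 → Function.Surjective (vecDeriv (E := EM) T.μ m)

/-- The zero level `μ⁻¹(0)`, as a topological subspace of `M`. -/
abbrev Level : Type _ := {m : M // T.μ m = 0}

/-- `𝒢` acts freely on `μ⁻¹(0)`. -/
def ActsFreely : Prop := ∀ (n : T.Level) (a : G), T.actG a n.1 = n.1 → a = 1

lemma μ_actG (n : T.Level) (a : G) : T.μ (T.actG a n.1) = 0 := by
  ext l : 1
  have h := T.μ_equivariant a n.1 l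
  rw [n.2] at h
  exact h.trans (map_zero _)

lemma μ_actSp (n : T.Level) (q : Sp1) : T.μ (T.actSp q n.1) = 0 := by
  have h := T.μ_permuting q n.1
  rw [n.2] at h
  exact h.trans (Γ.imActFun_zero q)

/-- The right action `n ↦ a⁻¹ n` of `𝒢` on `μ⁻¹(0)`. -/
def levelAct (n : T.Level) (a : G) : T.Level := ⟨T.actG a⁻¹ n.1, T.μ_actG n a⁻¹⟩

/-- The equivalence relation on `μ⁻¹(0)` whose classes are the `𝒢`-orbits. -/
def orbitSetoid : Setoid T.Level where
  r n n' := ∃ a : G, T.actG a n.1 = n'.1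
  iseqv := by
    refine ⟨fun n => ⟨1, by simp⟩, ?_, ?_⟩
    · rintro n n' ⟨a, h⟩
      exact ⟨a⁻¹, by rw [← h, ← Equiv.Perm.mul_apply, ← map_mul]; simp⟩
    · rintro n n' n'' ⟨a, h⟩ ⟨b, h'⟩
      exact ⟨b * a, by rw [← h', ← h, ← Equiv.Perm.mul_apply, ← map_mul]⟩

/-- The hyperKähler reduction `M₀ = μ⁻¹(0) / 𝒢`, with the quotient topology. -/
def Reduction : Type _ := Quotient T.orbitSetoid

instance : TopologicalSpace T.Reduction := inferInstanceAs (TopologicalSpace (Quotient _))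

/-- The projection `μ⁻¹(0) → M₀`. -/
def toReduction (n : T.Level) : T.Reduction := Quotient.mk T.orbitSetoid n

lemma actSp_actG (q : Sp1) (a : G) (m : M) :
    T.actSp q (T.actG a m) = T.actG (Γ.α q a) (T.actSp q m) := by
  simp only [actSp, actG, MonoidHom.comp_apply, ← Equiv.Perm.mul_apply, ← map_mul]
  congr 2
  ext <;> simp

/-- The map of `M₀` induced by the action of `q ∈ Sp(1)` on `M`. -/
def redActFun (q : Sp1) : T.Reduction → T.Reduction :=
  Quotient.map (fun n : T.Level => (⟨T.actSp q n.1, T.μ_actSp n q⟩ : T.Level)) (by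
    rintro n n' ⟨a, h⟩
    exact ⟨Γ.α q a, by simp only [← h, actSp_actG]⟩)

lemma redActFun_one (y : T.Reduction) : T.redActFun 1 y = y := by
  induction y using Quotient.inductionOn with
  | h n => exact congrArg (Quotient.mk T.orbitSetoid) (Subtype.ext (by simp))

lemma redActFun_mul (p q : Sp1) (y : T.Reduction) :
    T.redActFun (p * q) y = T.redActFun p (T.redActFun q y) := by
  induction y using Quotient.inductionOn with
  | h n => exact congrArg (Quotient.mk T.orbitSetoid) (Subtype.ext (by simp))

/-- The induced (permuting) action of `Sp(1)` on `M₀`. -/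
def redAct : Sp1 →* Equiv.Perm T.Reduction where
  toFun q :=
    { toFun := T.redActFun q
      invFun := T.redActFun q⁻¹
      left_inv := fun x => by rw [← redActFun_mul, inv_mul_cancel, redActFun_one]
      right_inv := fun x => by rw [← redActFun_mul, mul_inv_cancel, redActFun_one] }
  map_one' := by ext x : 1; exact T.redActFun_one x
  map_mul' p q := by ext x : 1; exact T.redActFun_mul p q x

/-- The space `H_m ⊆ T_m M`: the orthogonal complement of `K_m ⊕ I₁ K_m ⊕ I₂ K_m ⊕ I₃ K_m`,
where `K_m` is spanned by the Killing vectors. -/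
def IsHorizontal (m : M) (v : TangentSpace 𝓘(ℝ, EM) m) : Prop :=
  ∀ ξ : EG, T.hk.g.inner m (T.killing m ξ) v = 0 ∧
    ∀ l, T.hk.g.inner m (T.hk.I l m (T.killing m ξ)) v = 0

section ReducedStructure

variable {EN : Type*} [NormedAddCommGroup EN] [NormedSpace ℝ EN]
  {E0 : Type*} [NormedAddCommGroup E0] [NormedSpace ℝ E0]
  [ChartedSpace EN T.Level] [ChartedSpace E0 T.Reduction]

variable (EN) in
/-- `J` is the endomorphism of `T_y M₀` that corresponds to `I l` under the isomorphisms
`H_n ≅ T_y M₀` given by the differential of the projection at the points `n` over `y`. -/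
def IsReducedComplexStructure (l : Fin 3) (y : T.Reduction)
    (J : TangentSpace 𝓘(ℝ, E0) y →L[ℝ] TangentSpace 𝓘(ℝ, E0) y) : Prop :=
  ∀ (n : T.Level), T.toReduction n = y → ∀ v w : TangentSpace 𝓘(ℝ, EN) n,
    T.IsHorizontal n.1 (mfderiv 𝓘(ℝ, EN) 𝓘(ℝ, EM) (Subtype.val : T.Level → M) n v) →
    mfderiv 𝓘(ℝ, EN) 𝓘(ℝ, EM) (Subtype.val : T.Level → M) n w =
      T.hk.I l n.1 (mfderiv 𝓘(ℝ, EN) 𝓘(ℝ, EM) (Subtype.val : T.Level → M) n v) →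
    J (mfderiv 𝓘(ℝ, EN) 𝓘(ℝ, E0) T.toReduction n v : E0) =
      (mfderiv 𝓘(ℝ, EN) 𝓘(ℝ, E0) T.toReduction n w : E0)

open Classical in
variable (EN E0) in
/-- The complex structures of the hyperKähler reduction `M₀`. -/
def redI (l : Fin 3) (y : T.Reduction) :
    TangentSpace 𝓘(ℝ, E0) y →L[ℝ] TangentSpace 𝓘(ℝ, E0) y :=
  if h : ∃ J, T.IsReducedComplexStructure EN l y J then Classical.choose h else 0

end ReducedStructure

end Target

/-! ### The Dirac operator twisted by a 1-form with values in `𝕃` -/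

section Twisted

variable {X : Type*} [TopologicalSpace X] [ChartedSpace E4 X] [IsManifold 𝓘(ℝ, E4) ∞ X]
  {EQ : Type*} [NormedAddCommGroup EQ] [NormedSpace ℝ EQ]
  {g : ContMDiffRiemannianMetric 𝓘(ℝ, E4) ∞ E4 (fun x : X => TangentSpace 𝓘(ℝ, E4) x)}
  {o : ∀ x : X, Orientation ℝ (TangentSpace 𝓘(ℝ, E4) x) (Fin 4)}
  {Q : Type*} [TopologicalSpace Q] [ChartedSpace EQ Q] [IsManifold 𝓘(ℝ, EQ) ∞ Q]

/-- Smooth 1-forms on `X` with values in the bundle `𝕃 = Q₊ ×_{Sp₊(1)} ℒ`, i.e. basic equivariant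
`ℒ`-valued 1-forms on the principal bundle. -/
structure LForm (P : SpinStructure g o EQ Q) (Γ : SymmetryData EG G) where
  /-- the form on the principal bundle -/
  toFun : ∀ f : Q, TangentSpace 𝓘(ℝ, EQ) f →L[ℝ] EG
  smooth : ContMDiff 𝓘(ℝ, EQ).tangent 𝓘(ℝ, EG) ∞
    (fun w : TangentBundle 𝓘(ℝ, EQ) Q => toFun w.1 w.2)
  horizontal : ∀ (f : Q) (w : TangentSpace 𝓘(ℝ, EQ) f),
    mfderiv 𝓘(ℝ, EQ) 𝓘(ℝ, E4) P.proj f w = 0 → toFun f w = 0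
  equivariant : ∀ (f : Q) (s : Spin4) (w : TangentSpace 𝓘(ℝ, EQ) f),
    toFun (P.r f s) (mfderiv 𝓘(ℝ, EQ) 𝓘(ℝ, EQ) (fun f' => P.r f' s) f w) =
      Γ.dα s.1⁻¹ (toFun f w)

variable {P : SpinStructure g o EQ Q} {Γ : SymmetryData EG G}

/-- The section `ν`, as a map from the bundle `𝕄` with fibre `M` to the bundle
`Λ²₊ X ⊗ 𝕃 = Q₊ ×_{Sp₊(1)} (Im ℍ ⊗ ℒ)`; it is given by the moment map. -/
def nu (P : SpinStructure g o EQ Q) (T : Target EM M Γ) : P.Assoc T.actSp → P.Assoc Γ.imAct :=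
  SpinStructure.Assoc.map P T.μ T.μ_permuting

/-- The section `u` satisfies `ν ∘ u = 0`. -/
def NuVanishes (T : Target EM M Γ) (u : P.Section EM T.actSp) : Prop :=
  ∀ f : Q, nu P T (u.toFun (P.proj f)) = SpinStructure.Assoc.mk P Γ.imAct f 0

/-- `v` is the image of `u` under the fibrewise map `ν⁻¹(0) → 𝕄₀`, `[f, n] ↦ [f, [n]]`. -/
def IsProjection {E0 : Type*} [NormedAddCommGroup E0] [NormedSpace ℝ E0] (T : Target EM M Γ)
    [ChartedSpace E0 T.Reduction] (u : P.Section EM T.actSp) (v : P.Section E0 T.redAct) : Prop :=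
  ∀ (f : Q) (n : T.Level), u.toFun (P.proj f) = SpinStructure.Assoc.mk P T.actSp f n.1 →
    v.toFun (P.proj f) = SpinStructure.Assoc.mk P T.redAct f (T.toReduction n)

/-- The equivariant map on the `𝒢 ⋊ Sp(1)`-bundle `Q̂ = 𝒢 × Q` that represents the section `u`;
`𝒢` acts on `Q̂` from the right by multiplication on the first factor. -/
def hatMap (T : Target EM M Γ) (u : P.Section EM T.actSp) (p : G × Q) : M :=
  T.actG p.1⁻¹ (u.equivariantMap p.2)

/-- The covariant derivative `∇^B u` in the frame `f`: the restriction of the differential of the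
equivariant map on `Q̂` to the horizontal space of the connection `B` at the point `(1, f)`. Here
`B` is the connection whose pull-back by `f ↦ (1, f)` is `b + φ`, with `φ` the Levi-Civita
connection, so that `B (ξ, w) = ξ + b w + φ w` at `(1, f)` and the `B`-horizontal lift of `v` is
`(-b ṽ, ṽ)`, where `ṽ` is the Levi-Civita horizontal lift. -/
def covDeriv (A : P.LeviCivita) (T : Target EM M Γ) (b : LForm P Γ) (u : P.Section EM T.actSp)
    (f : Q) (v : TangentSpace 𝓘(ℝ, E4) (P.proj f)) :
    TangentSpace 𝓘(ℝ, EM) (u.equivariantMap f) :=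
  (mfderiv (𝓘(ℝ, EG).prod 𝓘(ℝ, EQ)) 𝓘(ℝ, EM) (hatMap T u) ((1 : G), f)
    ((-b.toFun f (A.lift f v), A.lift f v) : EG × EQ) : EM)

/-- The generalized Dirac operator `D_b u = 𝒞 (∇^B u)`, in the frame `f`. -/
def dirac (A : P.LeviCivita) (T : Target EM M Γ) (b : LForm P Γ) (u : P.Section EM T.actSp)
    (f : Q) (v : TangentSpace 𝓘(ℝ, E4) (P.proj f)) :
    TangentSpace 𝓘(ℝ, EM) (u.equivariantMap f) :=
  P.cliffordPart f (fun l => T.hk.I l (u.equivariantMap f)) (covDeriv A T b u f) v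

end Twisted

end Target

end

/-!
Let `û : Q → M` be the equivariant map of `u`. Since `ν ∘ u = 0`, it takes values in `μ⁻¹(0)`, and
its composition with the projection to `M₀` is the equivariant map of `v` (`isProjection_iff`,
`existsUnique_isProjection`).

At a point `m` of `μ⁻¹(0)` the space `ker dμ` is the orthogonal sum of the Killing vectors
`K_ξ` (`ξ ∈ ℒ`) and the space `H` of vectors `w` orthogonal to all `K_ξ` and all `I_l K_ξ`. The
moment map equation `⟨dμ_l, ξ⟩ = ω_l (K_ξ, ·)` shows that `ker dμ` is orthogonal to all `I_l K_ξ`,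
so that `I_l w`, for `w ∈ ker dμ`, is orthogonal to all Killing vectors; and `H` is preserved by the
`I_l`. Both sides of the equivalence turn out to say that the component in `H` of the covariant
derivative `∇^φ u` has vanishing `ℍ`-linear part (`SpinStructure.Section.IsHorizontallyHarmonic`).

*The twisted side.* `∇^B u = ∇^φ u + K_b` has values in `ker dμ`. If `D_b u = 0`, then
`∇^B u (w) = ∑ I_l ∇^B u (J_l w)` is orthogonal to the Killing vectors, hence `∇^B u` is the
component of `∇^φ u` in `H` (`twistedCov_eq_horCov`). Conversely, because `m` is a regular point of
`μ` the map `ξ ↦ K_ξ` is injective, so there is a form `b` for which `∇^B u` is this component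
(`horizontalForm`). Its coefficients are obtained by inverting the Gram matrix of the Killing
vectors, which gives smoothness, and it is `Sp(1)`-equivariant since `Sp(1)` acts by isometries
(`exists_dirac_eq_zero_iff`).

*The pure side.* The differential of `μ⁻¹(0) → M₀` has the Killing vectors as its kernel
(`Target.dred_eq_zero_iff`), so it maps `H` isomorphically onto the tangent space of `M₀`, and it
intertwines the complex structures by the definition of those of `M₀`. Here one needs that these do
not depend on the point of the fibre, i.e. that `𝒢` acts on `H` compatibly with the metric and the
complex structures (`Target.exists_isReducedComplexStructure`). It carries the component of `∇^φ u`
in `H` to the covariant derivative of `v` (`pureDirac_redI_eq_zero_iff`).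

Tangent spaces are identified with the model spaces throughout: differentials are used in the form
`mderiv`, whose type does not depend on the point.
-/

noncomputable section

/-! ### Chain rules -/

section ChainRule

variable {E₁ : Type*} [NormedAddCommGroup E₁] [NormedSpace ℝ E₁] {H₁ : Type*} [TopologicalSpace H₁]
  {I₁ : ModelWithCorners ℝ E₁ H₁} {M₁ : Type*} [TopologicalSpace M₁] [ChartedSpace H₁ M₁]
  {E₂ : Type*} [NormedAddCommGroup E₂] [NormedSpace ℝ E₂] {H₂ : Type*} [TopologicalSpace H₂]
  {I₂ : ModelWithCorners ℝ E₂ H₂} {M₂ : Type*} [TopologicalSpace M₂] [ChartedSpace H₂ M₂]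
  {E₃ : Type*} [NormedAddCommGroup E₃] [NormedSpace ℝ E₃] {H₃ : Type*} [TopologicalSpace H₃]
  {I₃ : ModelWithCorners ℝ E₃ H₃} {M₃ : Type*} [TopologicalSpace M₃] [ChartedSpace H₃ M₃]
  {E₄ : Type*} [NormedAddCommGroup E₄] [NormedSpace ℝ E₄] {H₄ : Type*} [TopologicalSpace H₄]
  {I₄ : ModelWithCorners ℝ E₄ H₄} {M₄ : Type*} [TopologicalSpace M₄] [ChartedSpace H₄ M₄]

variable (I₁ I₂) in
/-- The differential of `f` at `x`, with both tangent spaces identified with the model spaces. All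
computations below are made with it: its type does not depend on the points `x` and `f x`, so that
these can be rewritten freely. -/
def mderiv (f : M₁ → M₂) (x : M₁) : E₁ →L[ℝ] E₂ := mfderiv I₁ I₂ f x

lemma mderiv_congr {f g : M₁ → M₂} {x : M₁} (h : f =ᶠ[𝓝 x] g) :
    mderiv I₁ I₂ f x = mderiv I₁ I₂ g x := by
  unfold mderiv
  exact h.mfderiv_eq

lemma mderiv_const (x : M₁) (c : M₂) : mderiv I₁ I₂ (fun _ => c) x = 0 :=
  mfderiv_const

lemma mderiv_id (x : M₁) : mderiv I₁ I₁ (fun y => y) x = ContinuousLinearMap.id ℝ E₁ :=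
  mfderiv_id

/-- The chain rule; the point `y = f x` is a variable, so that the rule can be used where this
equation does not hold by definition. -/
lemma mderiv_comp {g : M₂ → M₃} {f : M₁ → M₂} {x : M₁} {y : M₂}
    (hg : MDifferentiableAt I₂ I₃ g y) (hf : MDifferentiableAt I₁ I₂ f x) (hy : f x = y) (v : E₁) :
    mderiv I₁ I₃ (fun x => g (f x)) x v = mderiv I₂ I₃ g y (mderiv I₁ I₂ f x v) := by
  subst hy
  exact DFunLike.congr_fun (mfderiv_comp x hg hf) v

lemma mderiv_prod {Φ : M₂ → M₃ → M₄} {y : M₂} {z : M₃}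
    (hΦ : MDifferentiableAt (I₂.prod I₃) I₄ (fun p : M₂ × M₃ => Φ p.1 p.2) (y, z)) (v : E₂)
    (w : E₃) : mderiv (I₂.prod I₃) I₄ (fun p : M₂ × M₃ => Φ p.1 p.2) (y, z) (v, w) =
      mderiv I₂ I₄ (fun y => Φ y z) y v + mderiv I₃ I₄ (fun z => Φ y z) z w :=
  mfderiv_prod_eq_add_apply hΦ

lemma mderiv_comp₂ {Φ : M₂ → M₃ → M₄} {a : M₁ → M₂} {b : M₁ → M₃} {x : M₁} {y : M₂} {z : M₃}
    (hΦ : MDifferentiableAt (I₂.prod I₃) I₄ (fun p : M₂ × M₃ => Φ p.1 p.2) (y, z))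
    (ha : MDifferentiableAt I₁ I₂ a x) (hb : MDifferentiableAt I₁ I₃ b x) (hy : a x = y)
    (hz : b x = z) (v : E₁) :
    mderiv I₁ I₄ (fun x => Φ (a x) (b x)) x v =
      mderiv I₂ I₄ (fun y => Φ y z) y (mderiv I₁ I₂ a x v) +
      mderiv I₃ I₄ (fun z => Φ y z) z (mderiv I₁ I₃ b x v) := by
  subst hy hz
  have h := mderiv_comp (I₁ := I₁) (x := x) (f := fun x => (a x, b x)) hΦ (ha.prodMk hb) rfl v
  have hp : mderiv I₁ (I₂.prod I₃) (fun x => (a x, b x)) x v =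
      (mderiv I₁ I₂ a x v, mderiv I₁ I₃ b x v) := by
    unfold mderiv
    rw [mfderiv_prodMk ha hb]
    rfl
  rw [h, hp, mderiv_prod hΦ]

end ChainRule

/-! ### Curves in level sets, immersions and principal bundles -/

/-- A regular zero level contains a smooth curve in every direction of the kernel of the derivative
(vector space version). -/
lemma exists_curve_of_surjective_fderiv {E V : Type*} [NormedAddCommGroup E] [NormedSpace ℝ E]
    [FiniteDimensional ℝ E] [NormedAddCommGroup V] [NormedSpace ℝ V] [FiniteDimensional ℝ V]
    {F : E → V} {x : E} (hF : ContDiffAt ℝ ∞ F x) (h0 : F x = 0)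
    (hsurj : Function.Surjective (fderiv ℝ F x)) {v : E} (hv : fderiv ℝ F x v = 0) :
    ∃ γ : ℝ → E, ContDiffAt ℝ ∞ γ 0 ∧ γ 0 = x ∧ HasDerivAt γ v 0 ∧ ∀ᶠ t in 𝓝 0, F (γ t) = 0 := by
  have : CompleteSpace E := FiniteDimensional.complete ℝ E
  set F' := fderiv ℝ F x with hF'
  obtain ⟨R, hR⟩ := F'.exists_rightInverse_of_surjective (LinearMap.range_eq_top.2 hsurj)
  have hR' : ∀ y, F' (R y) = y := fun y => DFunLike.congr_fun hR y
  -- `Ψ` straightens the level set: it has derivative `id` at `x` and `F' (Ψ y - x) = F y`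
  let Ψ : E → E := fun y => y - R (F' (y - x)) + R (F y)
  have hΨx : Ψ x = x := by simp [Ψ, h0]
  have hΨs : ContDiffAt ℝ ∞ Ψ x := by fun_prop
  have hFd : HasFDerivAt F F' x := (hF.differentiableAt (by simp)).hasFDerivAt
  have hΨd : HasFDerivAt Ψ ((ContinuousLinearEquiv.refl ℝ E : E ≃L[ℝ] E) : E →L[ℝ] E) x := by
    have h1 : HasFDerivAt (fun y : E => y - x) (ContinuousLinearMap.id ℝ E) x :=
      (hasFDerivAt_id x).sub_const x
    have h2 := (R.hasFDerivAt.comp x (F'.hasFDerivAt.comp x h1))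
    have h3 := R.hasFDerivAt.comp x hFd
    have h4 := ((hasFDerivAt_id x).sub h2).add h3
    refine h4.congr_fderiv ?_
    ext y; simp
  have hΨF : ∀ y, F' (Ψ y - x) = F y := fun y => by simp [Ψ, map_sub, map_add, hR']
  have hst : HasStrictFDerivAt Ψ ((ContinuousLinearEquiv.refl ℝ E : E ≃L[ℝ] E) : E →L[ℝ] E) x :=
    hΨs.hasStrictFDerivAt' hΨd (by simp)
  let ψ := hst.localInverse
  have hψs : ContDiffAt ℝ ∞ ψ (Ψ x) := hΨs.to_localInverse hΨd (by simp)
  have hψx : ψ x = x := by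
    have := hst.localInverse_apply_image
    rwa [hΨx] at this
  have hψd : HasFDerivAt ψ (ContinuousLinearMap.id ℝ E) x := by
    have := hst.to_localInverse.hasFDerivAt
    rw [hΨx] at this
    exact this
  have hψr : ∀ᶠ y in 𝓝 x, Ψ (ψ y) = y := by
    have := hst.eventually_right_inverse
    rwa [hΨx] at this
  rw [hΨx] at hψs
  have hl : HasDerivAt (fun t : ℝ => x + t • v) v 0 := by
    simpa using ((hasDerivAt_id (0 : ℝ)).smul_const v).const_add x
  refine ⟨fun t => ψ (x + t • v), ?_, by simp [hψx], ?_, ?_⟩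
  · refine ContDiffAt.comp (0 : ℝ) (g := ψ) (f := fun t : ℝ => x + t • v) ?_ (by fun_prop)
    simpa using hψs
  · have := HasFDerivAt.comp_hasDerivAt (0 : ℝ) (l := ψ) (l' := ContinuousLinearMap.id ℝ E)
      (by simpa using hψd) hl
    simpa [Function.comp_def] using this
  · have hc : Filter.Tendsto (fun t : ℝ => x + t • v) (𝓝 0) (𝓝 x) := by
      simpa using hl.continuousAt.tendsto
    filter_upwards [hc.eventually hψr] with t ht
    rw [← hΨF, ht]
    simp [hv]

/-- A regular zero level contains a smooth curve in every direction of the kernel of the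
derivative; no manifold structure on the level is used. -/
lemma exists_curve_of_surjective_mfderiv {E V : Type*} [NormedAddCommGroup E] [NormedSpace ℝ E]
    [FiniteDimensional ℝ E] [NormedAddCommGroup V] [NormedSpace ℝ V] [FiniteDimensional ℝ V]
    {M : Type*} [TopologicalSpace M] [ChartedSpace E M] [IsManifold 𝓘(ℝ, E) ∞ M]
    {h : M → V} {m : M} (hs : ContMDiffAt 𝓘(ℝ, E) 𝓘(ℝ, V) ∞ h m) (h0 : h m = 0)
    (hsurj : Function.Surjective (mderiv 𝓘(ℝ, E) 𝓘(ℝ, V) h m)) {v : E}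
    (hv : mderiv 𝓘(ℝ, E) 𝓘(ℝ, V) h m v = 0) :
    ∃ γ : ℝ → M, ContMDiffAt 𝓘(ℝ, ℝ) 𝓘(ℝ, E) ∞ γ 0 ∧ γ 0 = m ∧
      mderiv 𝓘(ℝ, ℝ) 𝓘(ℝ, E) γ 0 1 = v ∧ ∀ᶠ t in 𝓝 0, h (γ t) = 0 := by
  set φ := extChartAt 𝓘(ℝ, E) m with hφ
  have hd : ∀ w, mderiv 𝓘(ℝ, E) 𝓘(ℝ, V) h m w = fderiv ℝ (h ∘ φ.symm) (φ m) w := by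
    intro w
    simp only [mderiv, mfderiv, hs.mdifferentiableAt (by simp), writtenInExtChartAt,
      modelWithCornersSelf_coe, Set.range_id, fderivWithin_univ]
    rfl
  have hF : ContDiffAt ℝ ∞ (h ∘ φ.symm) (φ m) := by
    rw [← contMDiffAt_iff_contDiffAt]
    refine ContMDiffAt.comp (φ m) (I' := 𝓘(ℝ, E)) (g := h) (f := φ.symm) ?_ ?_
    · rw [extChartAt_to_inv]; exact hs
    · exact (contMDiffOn_extChartAt_symm m).contMDiffAt (extChartAt_target_mem_nhds m)
  have hF0 : (h ∘ φ.symm) (φ m) = 0 := by simp [hφ, h0]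
  obtain ⟨γ, hγ, hγ0, hγd, hγF⟩ := exists_curve_of_surjective_fderiv hF hF0
    (fun y => by obtain ⟨w, hw⟩ := hsurj y; exact ⟨w, (hd w).symm.trans hw⟩)
    (v := v) ((hd v).symm.trans hv)
  have hsm : ContMDiffAt 𝓘(ℝ, ℝ) 𝓘(ℝ, E) ∞ (φ.symm ∘ γ) 0 := by
    refine ContMDiffAt.comp (0 : ℝ) (I' := 𝓘(ℝ, E)) (g := φ.symm) (f := γ) ?_ hγ.contMDiffAt
    rw [hγ0]
    exact (contMDiffOn_extChartAt_symm m).contMDiffAt (extChartAt_target_mem_nhds m)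
  have hm : (φ.symm ∘ γ) 0 = m := by simp [hφ, hγ0]
  refine ⟨φ.symm ∘ γ, hsm, hm, ?_, hγF⟩
  have : HasMFDerivAt 𝓘(ℝ, ℝ) 𝓘(ℝ, E) (φ.symm ∘ γ) 0
      (ContinuousLinearMap.toSpanSingleton ℝ v) := by
    refine ⟨hsm.continuousAt, ?_⟩
    simp only [writtenInExtChartAt, hm, extChartAt_model_space_eq_id, PartialEquiv.refl_coe,
      PartialEquiv.refl_symm, modelWithCornersSelf_coe, Set.range_id]
    refine HasFDerivAt.hasFDerivWithinAt (x := (0 : ℝ)) (𝕜 := ℝ) ?_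
    refine hγd.hasFDerivAt.congr_of_eventuallyEq ?_
    have : ∀ᶠ t in 𝓝 (0 : ℝ), γ t ∈ φ.target := by
      refine hγ.continuousAt.eventually_mem ?_
      rw [hγ0]; exact extChartAt_target_mem_nhds m
    filter_upwards [this] with t ht
    exact φ.right_inv ht
  rw [mderiv, this.mfderiv]
  exact one_smul ℝ v

lemma Manifold.IsImmersionAt.mderiv_injective {E E' : Type*} [NormedAddCommGroup E]
    [NormedSpace ℝ E] [NormedAddCommGroup E'] [NormedSpace ℝ E']
    {N M : Type*} [TopologicalSpace N] [ChartedSpace E N] [IsManifold 𝓘(ℝ, E) ∞ N]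
    [TopologicalSpace M] [ChartedSpace E' M] [IsManifold 𝓘(ℝ, E') ∞ M]
    {f : N → M} {x : N} (h : Manifold.IsImmersionAt 𝓘(ℝ, E) 𝓘(ℝ, E') ∞ f x) :
    Function.Injective (mderiv 𝓘(ℝ, E) 𝓘(ℝ, E') f x) := by
  set c := h.codChart.extend 𝓘(ℝ, E')
  set d := h.domChart.extend 𝓘(ℝ, E)
  -- a smooth local left inverse of `f`, read off from the normal form `u ↦ (u, 0)`
  let k : M → N := fun y => d.symm (h.equiv.symm (c y)).1
  have hk : ∀ y ∈ h.domChart.source, k (f y) = y := by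
    intro y hy
    have h1 := h.writtenInCharts (show d y ∈ d.target from d.map_source (by
      rwa [h.domChart.extend_source]))
    have h2 : d.symm (d y) = y := h.domChart.extend_left_inv hy
    simp only [Function.comp_apply] at h1
    change c (f (d.symm (d y))) = _ at h1
    rw [h2] at h1
    simp [k, h1, h2]
  have hev : k ∘ f =ᶠ[𝓝 x] id :=
    Filter.eventually_of_mem (h.domChart.open_source.mem_nhds h.mem_domChart_source) hk
  have hkx : (h.equiv.symm (c (f x))).1 = d x := by
    have h1 := h.writtenInCharts (show d x ∈ d.target from d.map_source (by
      rw [h.domChart.extend_source]; exact h.mem_domChart_source))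
    have h2 : d.symm (d x) = x := h.domChart.extend_left_inv h.mem_domChart_source
    simp only [Function.comp_apply] at h1
    change c (f (d.symm (d x))) = _ at h1
    rw [h2] at h1
    simp [h1]
  have hks : ContMDiffAt 𝓘(ℝ, E') 𝓘(ℝ, E) ∞ k (f x) := by
    have h1 : ContMDiffAt 𝓘(ℝ, E') 𝓘(ℝ, E') ∞ c (f x) :=
      (OpenPartialHomeomorph.contMDiffOn_extend h.codChart_mem_maximalAtlas).contMDiffAt
        (h.codChart.open_source.mem_nhds h.mem_codChart_source)
    have h2 : ContMDiffAt 𝓘(ℝ, E') 𝓘(ℝ, E) ∞ (fun z => (h.equiv.symm z).1) (c (f x)) :=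
      (contDiff_fst.comp h.equiv.symm.contDiff).contDiffAt.contMDiffAt
    have h3 : ContMDiffAt 𝓘(ℝ, E) 𝓘(ℝ, E) ∞ d.symm (h.equiv.symm (c (f x))).1 := by
      rw [hkx]
      refine (contMDiffOn_extend_symm h.domChart_mem_maximalAtlas).contMDiffAt ?_
      refine Filter.mem_of_superset (h.domChart.open_target.mem_nhds
        (h.domChart.map_source h.mem_domChart_source)) ?_
      intro z hz; simpa using hz
    exact h3.comp (f x) (h2.comp (f x) h1)
  have hd : ∀ v, v = mderiv 𝓘(ℝ, E') 𝓘(ℝ, E) k (f x) (mderiv 𝓘(ℝ, E) 𝓘(ℝ, E') f x v) := by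
    intro v
    rw [← mderiv_comp (hks.mdifferentiableAt (by simp)) (h.contMDiffAt.mdifferentiableAt (by simp))
      rfl, mderiv_congr (f := fun y => k (f y)) (g := fun y => y) hev,
      mderiv_id]
    rfl
  intro v w hvw
  rw [hd v, hvw, ← hd w]

namespace IsPrincipalBundle

variable {EB : Type*} [NormedAddCommGroup EB] [NormedSpace ℝ EB]
  {B : Type*} [TopologicalSpace B] [ChartedSpace EB B]
  {EP : Type*} [NormedAddCommGroup EP] [NormedSpace ℝ EP]
  {P : Type*} [TopologicalSpace P] [ChartedSpace EP P]
  {ES : Type*} [NormedAddCommGroup ES] [NormedSpace ℝ ES]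
  {HS : Type*} [TopologicalSpace HS]
  {S : Type*} [TopologicalSpace S] [ChartedSpace HS S] [Group S]
  {IS : ModelWithCorners ℝ ES HS} {proj : P → B} {r : P → S → P}

lemma surjective (h : IsPrincipalBundle (EB := EB) (EP := EP) IS proj r) :
    Function.Surjective proj := by
  intro x
  obtain ⟨U, -, hx, σ, -, -, hσ, -⟩ := h.locallyTrivial x
  exact ⟨σ x, hσ x hx⟩

lemma exists_act_eq (h : IsPrincipalBundle (EB := EB) (EP := EP) IS proj r) {p p' : P}
    (hp : proj p = proj p') : ∃ s, r p s = p' := by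
  obtain ⟨U, -, hx, σ, τ, -, -, -, hr⟩ := h.locallyTrivial (proj p)
  have h1 := hr p hx
  have h2 := hr p' (show proj p' ∈ U from hp ▸ hx)
  refine ⟨(τ p)⁻¹ * τ p', ?_⟩
  rw [← hp] at h2
  calc r p ((τ p)⁻¹ * τ p') = r (r (σ (proj p)) (τ p)) ((τ p)⁻¹ * τ p') := by rw [h1]
    _ = p' := by rw [← h.act_mul, mul_inv_cancel_left, h2]

lemma smooth_act_left (h : IsPrincipalBundle (EB := EB) (EP := EP) IS proj r) (s : S) :
    ContMDiff 𝓘(ℝ, EP) 𝓘(ℝ, EP) ∞ (fun p => r p s) :=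
  h.smooth_act.comp (contMDiff_id.prodMk contMDiff_const)

lemma smooth_act_right (h : IsPrincipalBundle (EB := EB) (EP := EP) IS proj r) (p : P) :
    ContMDiff IS 𝓘(ℝ, EP) ∞ (fun s => r p s) :=
  h.smooth_act.comp (contMDiff_const.prodMk contMDiff_id)

/-- There is a smooth local section through every point. -/
lemma exists_section (h : IsPrincipalBundle (EB := EB) (EP := EP) IS proj r) (p : P) :
    ∃ σ : B → P, ContMDiffAt 𝓘(ℝ, EB) 𝓘(ℝ, EP) ∞ σ (proj p) ∧ σ (proj p) = p ∧
      ∀ᶠ y in 𝓝 (proj p), proj (σ y) = y := by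
  obtain ⟨U, hU, hx, σ, τ, hσ, hσp, -, hr⟩ := h.locallyTrivial (proj p)
  refine ⟨fun y => r (σ y) (τ p), ?_, hr p hx, ?_⟩
  · exact (h.smooth_act_left (τ p)).contMDiffAt.comp _ (hσ.contMDiffAt (hU.mem_nhds hx))
  · filter_upwards [hU.mem_nhds hx] with y hy
    rw [h.proj_act, hσp y hy]

lemma exists_mderiv_proj_eq (h : IsPrincipalBundle (EB := EB) (EP := EP) IS proj r) (p : P)
    (v : EB) : ∃ w : EP, mderiv 𝓘(ℝ, EP) 𝓘(ℝ, EB) proj p w = v := by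
  obtain ⟨σ, hσ, hσp, hev⟩ := h.exists_section p
  refine ⟨mderiv 𝓘(ℝ, EB) 𝓘(ℝ, EP) σ (proj p) v, ?_⟩
  rw [← mderiv_comp ((h.smooth_proj p).mdifferentiableAt (by simp))
      (hσ.mdifferentiableAt (by simp)) hσp v,
    mderiv_congr (f := fun y => proj (σ y)) (g := fun y => y) hev, mderiv_id]
  rfl

lemma mderiv_proj_vertical (h : IsPrincipalBundle (EB := EB) (EP := EP) IS proj r) (p : P)
    (ζ : ES) : mderiv 𝓘(ℝ, EP) 𝓘(ℝ, EB) proj p (mderiv IS 𝓘(ℝ, EP) (fun s => r p s) 1 ζ) = 0 := by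
  rw [← mderiv_comp ((h.smooth_proj p).mdifferentiableAt (by simp))
    ((h.smooth_act_right p 1).mdifferentiableAt (by simp)) (h.act_one p) ζ]
  simp only [h.proj_act, mderiv_const]
  rfl

/-- The kernel of the differential of the projection consists of the values of the fundamental
vector fields. -/
lemma exists_vertical (h : IsPrincipalBundle (EB := EB) (EP := EP) IS proj r)
    (hmul : ∀ s : S, ContMDiff IS IS ∞ (fun t : S => s * t)) (p : P)
    {w : EP} (hw : mderiv 𝓘(ℝ, EP) 𝓘(ℝ, EB) proj p w = 0) :
    ∃ ζ : ES, mderiv IS 𝓘(ℝ, EP) (fun s => r p s) 1 ζ = w := by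
  obtain ⟨U, hU, hx, σ, τ, hσ, hσp, hτ, hr⟩ := h.locallyTrivial (proj p)
  -- near `p` the identity is `q ↦ r (κ (proj q)) ((τ p)⁻¹ τ q)`, and `κ ∘ proj` is constant to
  -- first order in the vertical direction `w`
  have hUp : proj ⁻¹' U ∈ 𝓝 p := h.smooth_proj.continuous.continuousAt.preimage_mem_nhds
    (hU.mem_nhds hx)
  have hθ : MDifferentiableAt 𝓘(ℝ, EP) IS (fun q => (τ p)⁻¹ * τ q) p :=
    ((hmul (τ p)⁻¹).contMDiffAt.comp p (hτ.contMDiffAt hUp)).mdifferentiableAt (by simp)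
  let κ : B → P := fun y => r (σ y) (τ p)
  have hκ : MDifferentiableAt 𝓘(ℝ, EB) 𝓘(ℝ, EP) κ (proj p) :=
    ((h.smooth_act_left (τ p)).contMDiffAt.comp _
      (hσ.contMDiffAt (hU.mem_nhds hx))).mdifferentiableAt (by simp)
  have hproj : MDifferentiableAt 𝓘(ℝ, EP) 𝓘(ℝ, EB) proj p :=
    (h.smooth_proj p).mdifferentiableAt (by simp)
  have h1 := mderiv_comp₂ (Φ := r) (a := fun q => κ (proj q)) (y := p)
    (z := 1) ((h.smooth_act (p, 1)).mdifferentiableAt (by simp)) (hκ.comp p hproj) hθ (hr p hx)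
    (inv_mul_cancel _) w
  have h2 : (fun q => r (κ (proj q)) ((τ p)⁻¹ * τ q)) =ᶠ[𝓝 p] fun q => q := by
    refine Filter.eventually_of_mem hUp fun q hq => ?_
    simp only [κ]
    rw [← h.act_mul, mul_inv_cancel_left, hr q hq]
  rw [mderiv_congr h2, mderiv_id, mderiv_comp hκ hproj rfl w, hw, map_zero, map_zero, zero_add]
    at h1
  exact ⟨_, h1.symm⟩

end IsPrincipalBundle

/-! ### The Lie algebra of `Sp(1)` and horizontal lifts -/

section Sp1

lemma Sp1.contMDiff_mul_left (s : Sp1) : ContMDiff (𝓡 3) (𝓡 3) ∞ (fun t : Sp1 => s * t) := by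
  have h : ContMDiff (𝓡 3) 𝓘(ℝ, ℍ[ℝ]) ∞ (fun t : Sp1 => (s : ℍ[ℝ]) * (t : ℍ[ℝ])) :=
    (contDiff_const.mul contDiff_id).contMDiff.comp contMDiff_coe_sphere
  exact h.codRestrict_sphere fun t => (s * t).2

lemma Spin4.contMDiff_mul_left (s : Spin4) :
    ContMDiff modelSpin4 modelSpin4 ∞ (fun t : Spin4 => s * t) :=
  ((Sp1.contMDiff_mul_left s.1).comp contMDiff_fst).prodMk
    ((Sp1.contMDiff_mul_left s.2).comp contMDiff_snd)

/-- The identification of the tangent space of `Sp(1)` at `1` with `Im ℍ`. -/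
def sp1Val : EuclideanSpace ℝ (Fin 3) →L[ℝ] ℍ[ℝ] :=
  mderiv (𝓡 3) 𝓘(ℝ, ℍ[ℝ]) (fun q : Sp1 => (q : ℍ[ℝ])) 1

lemma sp1Val_injective : Function.Injective sp1Val :=
  injective_mvfderiv_subtypeVal_sphere (1 : Sp1)

lemma range_sp1Val : sp1Val.range = (Submodule.span ℝ {(1 : ℍ[ℝ])})ᗮ :=
  range_mvfderiv_subtypeVal (1 : Sp1)

lemma exists_sp1Val_eq {a : ℍ[ℝ]} (ha : a.re = 0) : ∃ ζ, sp1Val ζ = a := by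
  have h : a ∈ sp1Val.range := by
    rw [range_sp1Val, Submodule.mem_orthogonal_singleton_iff_inner_right]
    simp [Quaternion.inner_def, ha]
  exact h

lemma exists_sp1Coord : ∃ c : ℍ[ℝ] →ₗ[ℝ] EuclideanSpace ℝ (Fin 3),
    c ∘ₗ (sp1Val : EuclideanSpace ℝ (Fin 3) →ₗ[ℝ] ℍ[ℝ]) = LinearMap.id :=
  LinearMap.exists_leftInverse_of_injective _ (LinearMap.ker_eq_bot.2 sp1Val_injective)

/-- A linear left inverse of `sp1Val`. Its values outside `Im ℍ` are arbitrary; it is only applied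
to the connection forms, which are imaginary. -/
def sp1Coord : ℍ[ℝ] →L[ℝ] EuclideanSpace ℝ (Fin 3) :=
  LinearMap.toContinuousLinearMap (Classical.choose exists_sp1Coord)

lemma sp1Coord_sp1Val (ζ : EuclideanSpace ℝ (Fin 3)) : sp1Coord (sp1Val ζ) = ζ :=
  DFunLike.congr_fun (Classical.choose_spec exists_sp1Coord) ζ

lemma sp1Val_sp1Coord {a : ℍ[ℝ]} (ha : a.re = 0) : sp1Val (sp1Coord a) = a := by
  obtain ⟨ζ, rfl⟩ := exists_sp1Val_eq ha
  rw [sp1Coord_sp1Val]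

lemma mderiv_spin4_fst (ζ : EuclideanSpace ℝ (Fin 3) × EuclideanSpace ℝ (Fin 3)) :
    mderiv modelSpin4 𝓘(ℝ, ℍ[ℝ]) (fun s : Spin4 => (s.1 : ℍ[ℝ])) 1 ζ = sp1Val ζ.1 := by
  rw [mderiv_comp (I₂ := 𝓡 3) (g := fun q : Sp1 => (q : ℍ[ℝ])) (f := fun s : Spin4 => s.1)
    (contMDiff_coe_sphere.mdifferentiableAt one_ne_zero) mdifferentiableAt_fst rfl]
  unfold mderiv
  rw [mfderiv_fst]
  rfl

lemma mderiv_spin4_snd (ζ : EuclideanSpace ℝ (Fin 3) × EuclideanSpace ℝ (Fin 3)) :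
    mderiv modelSpin4 𝓘(ℝ, ℍ[ℝ]) (fun s : Spin4 => (s.2 : ℍ[ℝ])) 1 ζ = sp1Val ζ.2 := by
  rw [mderiv_comp (I₂ := 𝓡 3) (g := fun q : Sp1 => (q : ℍ[ℝ])) (f := fun s : Spin4 => s.2)
    (contMDiff_coe_sphere.mdifferentiableAt one_ne_zero) mdifferentiableAt_snd rfl]
  unfold mderiv
  rw [mfderiv_snd]
  rfl

end Sp1

namespace SpinStructure

variable {X : Type*} [TopologicalSpace X] [ChartedSpace E4 X] [IsManifold 𝓘(ℝ, E4) ∞ X]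
  {g : ContMDiffRiemannianMetric 𝓘(ℝ, E4) ∞ E4 (fun x : X => TangentSpace 𝓘(ℝ, E4) x)}
  {o : ∀ x : X, Orientation ℝ (TangentSpace 𝓘(ℝ, E4) x) (Fin 4)}
  {EQ : Type*} [NormedAddCommGroup EQ] [NormedSpace ℝ EQ]
  {Q : Type*} [TopologicalSpace Q] [ChartedSpace EQ Q] [IsManifold 𝓘(ℝ, EQ) ∞ Q]

/-- The differential of the bundle projection. -/
def dproj (P : SpinStructure g o EQ Q) (f : Q) : EQ →L[ℝ] E4 := mderiv 𝓘(ℝ, EQ) 𝓘(ℝ, E4) P.proj f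

/-- The values at `f` of the fundamental vector fields of the principal `Spin(4)`-action. -/
def vert (P : SpinStructure g o EQ Q) (f : Q) :
    (EuclideanSpace ℝ (Fin 3) × EuclideanSpace ℝ (Fin 3)) →L[ℝ] EQ :=
  mderiv modelSpin4 𝓘(ℝ, EQ) (fun s : Spin4 => P.r f s) 1

/-- The differential of the action of `s`. -/
def dr (P : SpinStructure g o EQ Q) (f : Q) (s : Spin4) : EQ →L[ℝ] EQ :=
  mderiv 𝓘(ℝ, EQ) 𝓘(ℝ, EQ) (fun f' => P.r f' s) f

lemma dproj_vert (P : SpinStructure g o EQ Q) (f : Q)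
    (ζ : EuclideanSpace ℝ (Fin 3) × EuclideanSpace ℝ (Fin 3)) : P.dproj f (P.vert f ζ) = 0 :=
  P.principal.mderiv_proj_vertical f ζ

lemma dproj_dr (P : SpinStructure g o EQ Q) (f : Q) (s : Spin4) (w : EQ) :
    P.dproj (P.r f s) (P.dr f s w) = P.dproj f w := by
  unfold dproj dr
  rw [← mderiv_comp ((P.principal.smooth_proj _).mdifferentiableAt (by simp))
    ((P.principal.smooth_act_left s).mdifferentiableAt (by simp)) rfl]
  simp only [P.principal.proj_act]

namespace LeviCivita

variable {P : SpinStructure g o EQ Q} (A : P.LeviCivita)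

/-- The `sp₊(1)`-component of the connection, on the model space. -/
def fstForm (f : Q) : EQ →L[ℝ] ℍ[ℝ] := A.φ f

/-- The `sp₋(1)`-component of the connection, on the model space. -/
def sndForm (f : Q) : EQ →L[ℝ] ℍ[ℝ] := A.ψ f

lemma fstForm_vert (f : Q) (ζ : EuclideanSpace ℝ (Fin 3) × EuclideanSpace ℝ (Fin 3)) :
    A.fstForm f (P.vert f ζ) = sp1Val ζ.1 :=
  (A.vertical_φ f ζ).trans (mderiv_spin4_fst ζ)

lemma sndForm_vert (f : Q) (ζ : EuclideanSpace ℝ (Fin 3) × EuclideanSpace ℝ (Fin 3)) :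
    A.sndForm f (P.vert f ζ) = sp1Val ζ.2 :=
  (A.vertical_ψ f ζ).trans (mderiv_spin4_snd ζ)

lemma fstForm_dr (f : Q) (s : Spin4) (w : EQ) :
    A.fstForm (P.r f s) (P.dr f s w) = star (s.1 : ℍ[ℝ]) * A.fstForm f w * (s.1 : ℍ[ℝ]) :=
  A.equivariant_φ f s w

lemma sndForm_dr (f : Q) (s : Spin4) (w : EQ) :
    A.sndForm (P.r f s) (P.dr f s w) = star (s.2 : ℍ[ℝ]) * A.sndForm f w * (s.2 : ℍ[ℝ]) :=
  A.equivariant_ψ f s w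

/-- Tangent vectors of `Q` are determined by their projection to `X` and the connection form. -/
lemma ext_vec (f : Q) {w w' : EQ} (h : P.dproj f w = P.dproj f w')
    (hφ : A.fstForm f w = A.fstForm f w') (hψ : A.sndForm f w = A.sndForm f w') : w = w' := by
  obtain ⟨ζ, hζ⟩ := P.principal.exists_vertical Spin4.contMDiff_mul_left f (w := w - w')
    (by change P.dproj f (w - w') = 0; rw [map_sub, h, sub_self])
  change P.vert f ζ = w - w' at hζ
  have h1 : sp1Val ζ.1 = 0 := by rw [← A.fstForm_vert f, hζ, map_sub, hφ, sub_self]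
  have h2 : sp1Val ζ.2 = 0 := by rw [← A.sndForm_vert f, hζ, map_sub, hψ, sub_self]
  have h3 : ζ = 0 := Prod.ext (sp1Val_injective (h1.trans (map_zero _).symm))
    (sp1Val_injective (h2.trans (map_zero _).symm))
  rw [h3, map_zero] at hζ
  exact (sub_eq_zero.1 hζ.symm)

/-- The projection of `T_f Q` to the horizontal subspace of the connection, along the vertical
one. -/
def hor (f : Q) : EQ →L[ℝ] EQ :=
  ContinuousLinearMap.id ℝ EQ - (P.vert f).comp
    ((sp1Coord.comp (A.fstForm f)).prod (sp1Coord.comp (A.sndForm f)))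

lemma hor_apply (f : Q) (w : EQ) :
    A.hor f w = w - P.vert f (sp1Coord (A.fstForm f w), sp1Coord (A.sndForm f w)) := rfl

lemma fstForm_hor (f : Q) (w : EQ) : A.fstForm f (A.hor f w) = 0 := by
  rw [hor_apply, map_sub, fstForm_vert, sub_eq_zero]
  exact (sp1Val_sp1Coord (A.im_φ f w)).symm

lemma sndForm_hor (f : Q) (w : EQ) : A.sndForm f (A.hor f w) = 0 := by
  rw [hor_apply, map_sub, sndForm_vert, sub_eq_zero]
  exact (sp1Val_sp1Coord (A.im_ψ f w)).symm

lemma dproj_hor (f : Q) (w : EQ) : P.dproj f (A.hor f w) = P.dproj f w := by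
  rw [hor_apply, map_sub, dproj_vert, sub_zero]

lemma hor_dr (f : Q) (s : Spin4) (w : EQ) :
    A.hor (P.r f s) (P.dr f s w) = P.dr f s (A.hor f w) := by
  refine A.ext_vec (P.r f s) ?_ ?_ ?_
  · rw [dproj_hor, dproj_dr, dproj_dr, dproj_hor]
  · rw [fstForm_hor, fstForm_dr, fstForm_hor]; simp
  · rw [sndForm_hor, sndForm_dr, sndForm_hor]; simp

lemma hor_eq_zero {f : Q} {w : EQ} (hw : P.dproj f w = 0) : A.hor f w = 0 := by
  refine A.ext_vec f ?_ ?_ ?_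
  · rw [dproj_hor, hw, map_zero]
  · rw [fstForm_hor, map_zero]
  · rw [sndForm_hor, map_zero]

/-- The horizontal lift, on the model spaces. -/
def horLift (f : Q) (v : E4) : EQ := A.lift f v

lemma horLift_spec (f : Q) (v : E4) : P.dproj f (A.horLift f v) = v ∧
    A.fstForm f (A.horLift f v) = 0 ∧ A.sndForm f (A.horLift f v) = 0 := by
  obtain ⟨w, hw⟩ := P.principal.exists_mderiv_proj_eq f v
  exact Classical.epsilon_spec (p := fun w : TangentSpace 𝓘(ℝ, EQ) f =>
    mfderiv 𝓘(ℝ, EQ) 𝓘(ℝ, E4) P.proj f w = v ∧ A.φ f w = 0 ∧ A.ψ f w = 0)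
    ⟨A.hor f w, (A.dproj_hor f w).trans hw, A.fstForm_hor f w, A.sndForm_hor f w⟩

lemma hor_horLift (f : Q) (v : E4) : A.hor f (A.horLift f v) = A.horLift f v := by
  obtain ⟨-, h1, h2⟩ := A.horLift_spec f v
  rw [hor_apply, h1, h2, map_zero, ← Prod.zero_eq_mk, map_zero, sub_zero]

end LeviCivita

end SpinStructure

/-! ### Linear algebra along the zero level of the moment map -/

section HyperKahlerAlgebra

variable {EM : Type*} [NormedAddCommGroup EM] [NormedSpace ℝ EM]
  {M : Type*} [TopologicalSpace M] [ChartedSpace EM M] [IsManifold 𝓘(ℝ, EM) ∞ M]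

namespace HyperKahler

variable (K : HyperKahler EM M) (m : M)

/-- The metric at `m`, on the model space. -/
def metric : EM →L[ℝ] EM →L[ℝ] ℝ := K.g.inner m

/-- The complex structures at `m`, on the model space. -/
def cplx (l : Fin 3) : EM →L[ℝ] EM := K.I l m

lemma eq_zero_of_metric_self {v : EM} (h : K.metric m v v = 0) : v = 0 := by
  by_contra hv
  exact (K.g.pos m v hv).ne' h

lemma cplx_sq (l : Fin 3) (v : EM) : K.cplx m l (K.cplx m l v) = -v := K.I_sq l m v

lemma metric_cplx_cplx (l : Fin 3) (v w : EM) :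
    K.metric m (K.cplx m l v) (K.cplx m l w) = K.metric m v w := K.orthogonal l m v w

lemma metric_cplx_right (l : Fin 3) (v w : EM) :
    K.metric m v (K.cplx m l w) = -K.metric m (K.cplx m l v) w := by
  rw [← K.metric_cplx_cplx m l v, cplx_sq, map_neg]

/-- A vector orthogonal to `x, I₁ x, I₂ x, I₃ x` is orthogonal to all `I_l I_j x`. -/
lemma metric_cplx_cplx_eq_zero {x v : EM} (h0 : K.metric m x v = 0)
    (h : ∀ l, K.metric m (K.cplx m l x) v = 0) (l j : Fin 3) :
    K.metric m (K.cplx m l (K.cplx m j x)) v = 0 := by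
  have hsq : ∀ l w, K.cplx m l (K.cplx m l w) = -w := fun l w => K.cplx_sq m l w
  have h01 : ∀ w, K.cplx m 0 (K.cplx m 1 w) = K.cplx m 2 w := K.I_mul m
  have h02 : ∀ w, K.cplx m 0 (K.cplx m 2 w) = -K.cplx m 1 w := fun w => by rw [← h01, hsq]
  have h21 : ∀ w, K.cplx m 2 (K.cplx m 1 w) = -K.cplx m 0 w := fun w => by
    rw [← h01, hsq, map_neg]
  have h20 : ∀ w, K.cplx m 2 (K.cplx m 0 w) = K.cplx m 1 w := fun w => by
    have := hsq 2 (K.cplx m 1 w)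
    rw [h21, map_neg] at this
    exact neg_injective this
  have h12 : ∀ w, K.cplx m 1 (K.cplx m 2 w) = K.cplx m 0 w := fun w => by
    have := h20 (K.cplx m 2 w)
    rw [h02, map_neg, h21, neg_neg] at this
    exact this.symm
  have h10 : ∀ w, K.cplx m 1 (K.cplx m 0 w) = -K.cplx m 2 w := fun w => by
    rw [← h12, hsq]
  fin_cases l <;> fin_cases j <;>
    simp [hsq, h01, h02, h21, h20, h12, h10, h0, h]

end HyperKahler

end HyperKahlerAlgebra

namespace Target

variable {EG : Type*} [NormedAddCommGroup EG] [NormedSpace ℝ EG]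
  {G : Type*} [TopologicalSpace G] [ChartedSpace EG G] [Group G]
  {EM : Type*} [NormedAddCommGroup EM] [NormedSpace ℝ EM]
  {M : Type*} [TopologicalSpace M] [ChartedSpace EM M] [IsManifold 𝓘(ℝ, EM) ∞ M]
  {Γ : SymmetryData EG G} (T : Target EM M Γ)

lemma smooth_actG : ContMDiff (𝓘(ℝ, EG).prod 𝓘(ℝ, EM)) 𝓘(ℝ, EM) ∞
    (fun p : G × M => T.actG p.1 p.2) :=
  T.smooth_act.comp (contMDiff_fst.prodMk (contMDiff_const.prodMk contMDiff_snd))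

lemma smooth_actSp : ContMDiff ((𝓡 3).prod 𝓘(ℝ, EM)) 𝓘(ℝ, EM) ∞
    (fun p : Sp1 × M => T.actSp p.1 p.2) :=
  T.smooth_act.comp (contMDiff_const.prodMk (contMDiff_fst.prodMk contMDiff_snd))

lemma smooth_actG_left (a : G) : ContMDiff 𝓘(ℝ, EM) 𝓘(ℝ, EM) ∞ (fun m => T.actG a m) :=
  T.smooth_actG.comp (contMDiff_const.prodMk contMDiff_id)

lemma smooth_actG_right (m : M) : ContMDiff 𝓘(ℝ, EG) 𝓘(ℝ, EM) ∞ (fun a => T.actG a m) :=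
  T.smooth_actG.comp (contMDiff_id.prodMk contMDiff_const)

lemma smooth_actSp_left (q : Sp1) : ContMDiff 𝓘(ℝ, EM) 𝓘(ℝ, EM) ∞ (fun m => T.actSp q m) :=
  T.smooth_actSp.comp (contMDiff_const.prodMk contMDiff_id)

/-- The differential of the moment map. -/
def dμ (m : M) : EM →L[ℝ] Fin 3 → EG := mderiv 𝓘(ℝ, EM) 𝓘(ℝ, Fin 3 → EG) T.μ m

/-- The infinitesimal action `ξ ↦ K_ξ` at `m`. -/
def kill (m : M) : EG →L[ℝ] EM := mderiv 𝓘(ℝ, EG) 𝓘(ℝ, EM) (fun a => T.actG a m) 1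

/-- The differential of the action of `a ∈ 𝒢`. -/
def dactG (a : G) (m : M) : EM →L[ℝ] EM := mderiv 𝓘(ℝ, EM) 𝓘(ℝ, EM) (fun m => T.actG a m) m

/-- The differential of the action of `q ∈ Sp(1)`. -/
def dactSp (q : Sp1) (m : M) : EM →L[ℝ] EM := mderiv 𝓘(ℝ, EM) 𝓘(ℝ, EM) (fun m => T.actSp q m) m

lemma κ_dμ (l : Fin 3) (m : M) (v : EM) (ξ : EG) :
    Γ.κ (T.dμ m v l) ξ = T.hk.metric m (T.hk.cplx m l (T.kill m ξ)) v :=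
  T.moment l m v ξ

lemma metric_dactG (a : G) (m : M) (v w : EM) :
    T.hk.metric (T.actG a m) (T.dactG a m v) (T.dactG a m w) = T.hk.metric m v w :=
  T.isometric (SemidirectProduct.inl a) m v w

lemma metric_dactSp (q : Sp1) (m : M) (v w : EM) :
    T.hk.metric (T.actSp q m) (T.dactSp q m v) (T.dactSp q m w) = T.hk.metric m v w :=
  T.isometric (SemidirectProduct.inr q) m v w

lemma dactG_cplx (a : G) (l : Fin 3) (m : M) (v : EM) :
    T.dactG a m (T.hk.cplx m l v) = T.hk.cplx (T.actG a m) l (T.dactG a m v) :=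
  T.preserves_I a l m v

lemma dactSp_kill (q : Sp1) (m : M) (ξ : EG) :
    T.dactSp q m (T.kill m ξ) = T.kill (T.actSp q m) (Γ.dα q ξ) := by
  have h1 := mderiv_comp (g := fun m => T.actSp q m) (f := fun a => T.actG a m) (x := 1) (y := m)
    ((T.smooth_actSp_left q).mdifferentiableAt (by simp))
    ((T.smooth_actG_right m).mdifferentiableAt (by simp)) (by simp) ξ
  have h2 := mderiv_comp (g := fun a => T.actG a (T.actSp q m)) (f := fun a : G => Γ.α q a)
    (x := 1) (y := 1) ((T.smooth_actG_right _).mdifferentiableAt (by simp))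
    (Γ.mdifferentiable_α q 1) (by simp) ξ
  simp only [T.actSp_actG] at h1
  exact h1.symm.trans h2

lemma exists_kill_actSp (q : Sp1) (m : M) (ξ : EG) :
    ∃ η, T.kill (T.actSp q m) ξ = T.dactSp q m (T.kill m η) := by
  refine ⟨Γ.dα q⁻¹ ξ, ?_⟩
  rw [dactSp_kill, ← ContinuousLinearMap.comp_apply (Γ.dα q), ← Γ.dα_mul, mul_inv_cancel, Γ.dα_one]
  rfl

lemma exists_kill_actG [LieGroup 𝓘(ℝ, EG) ∞ G] (a : G) (m : M) (ξ : EG) :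
    ∃ η, T.kill (T.actG a m) ξ = T.dactG a m (T.kill m η) := by
  have hc : ContMDiff 𝓘(ℝ, EG) 𝓘(ℝ, EG) ∞ (fun b : G => a⁻¹ * b * a) :=
    (contMDiff_mul_right (a := a)).comp (contMDiff_mul_left (a := a⁻¹))
  refine ⟨mderiv 𝓘(ℝ, EG) 𝓘(ℝ, EG) (fun b : G => a⁻¹ * b * a) 1 ξ, ?_⟩
  have h1 := mderiv_comp (g := fun b => T.actG b m) (f := fun b : G => a⁻¹ * b * a)
    (x := 1) (y := 1) ((T.smooth_actG_right _).mdifferentiableAt (by simp))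
    (hc.mdifferentiableAt (by simp)) (by simp) ξ
  have h2 := mderiv_comp (g := fun m => T.actG a m) (f := fun b : G => T.actG (a⁻¹ * b * a) m)
    (x := 1) (y := m) ((T.smooth_actG_left a).mdifferentiableAt (by simp))
    (((T.smooth_actG_right m).comp hc).mdifferentiableAt (by simp)) (by simp) ξ
  have h3 : (fun b : G => T.actG a (T.actG (a⁻¹ * b * a) m)) = fun b => T.actG b (T.actG a m) := by
    funext b
    simp only [← Equiv.Perm.mul_apply, ← map_mul]
    congr 2
    group
  rw [h3, h1] at h2
  exact h2

/-- The definition of the horizontal vectors `H_m` in terms of the metric and the complex structures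
on the model space. -/
lemma isHorizontal_iff {m : M} {v : EM} : T.IsHorizontal m v ↔
    ∀ ξ, T.hk.metric m (T.kill m ξ) v = 0 ∧
      ∀ l, T.hk.metric m (T.hk.cplx m l (T.kill m ξ)) v = 0 := Iff.rfl

lemma IsHorizontal.cplx {m : M} {v : EM} (h : T.IsHorizontal m v) (l : Fin 3) :
    T.IsHorizontal m (T.hk.cplx m l v : EM) := by
  rw [isHorizontal_iff] at h ⊢
  intro ξ
  refine ⟨?_, fun j => ?_⟩
  · rw [HyperKahler.metric_cplx_right, (h ξ).2 l, neg_zero]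
  · rw [HyperKahler.metric_cplx_right, T.hk.metric_cplx_cplx_eq_zero m (h ξ).1 (h ξ).2, neg_zero]

lemma IsHorizontal.dactG [LieGroup 𝓘(ℝ, EG) ∞ G] {m : M} {v : EM} (h : T.IsHorizontal m v) (a : G) :
    T.IsHorizontal (T.actG a m) (T.dactG a m v : EM) := by
  rw [isHorizontal_iff] at h ⊢
  intro ξ
  obtain ⟨η, hη⟩ := T.exists_kill_actG a m ξ
  rw [hη]
  refine ⟨?_, fun j => ?_⟩
  · rw [metric_dactG, (h η).1]
  · rw [← dactG_cplx, metric_dactG, (h η).2]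

lemma dμ_kill {m : M} (hm : T.μ m = 0) (ξ : EG) : T.dμ m (T.kill m ξ) = 0 := by
  unfold dμ kill
  rw [← mderiv_comp (T.smooth_μ.mdifferentiableAt (by simp))
    ((T.smooth_actG_right m).mdifferentiableAt (by simp)) (by simp)]
  have h : (fun a => T.μ (T.actG a m)) = fun _ => 0 := funext fun a => T.μ_actG ⟨m, hm⟩ a
  rw [h, mderiv_const]
  rfl

lemma mderiv_actG_inv [LieGroup 𝓘(ℝ, EG) ∞ G] (m : M) (ξ : EG) :
    mderiv 𝓘(ℝ, EG) 𝓘(ℝ, EM) (fun a : G => T.actG a⁻¹ m) 1 ξ = -T.kill m ξ := by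
  -- differentiate `a⁻¹ (a m) = m`
  have hi : ContMDiff 𝓘(ℝ, EG) 𝓘(ℝ, EG) ∞ (fun a : G => a⁻¹) := contMDiff_inv 𝓘(ℝ, EG) ∞
  have h1 := mderiv_comp₂ (Φ := fun (a : G) (m : M) => T.actG a⁻¹ m) (a := fun a => a)
    (b := fun a => T.actG a m) (x := 1) (y := 1) (z := m)
    ((T.smooth_actG.comp ((hi.comp contMDiff_fst).prodMk contMDiff_snd)).mdifferentiableAt
      (by simp)) mdifferentiableAt_id
    ((T.smooth_actG_right m).mdifferentiableAt (by simp)) rfl (by simp) ξ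
  have h2 : (fun a : G => T.actG a⁻¹ (T.actG a m)) = fun _ => m := by
    funext a; simp [← Equiv.Perm.mul_apply]
  have h3 : (fun m => T.actG (1 : G)⁻¹ m) = fun m => m := by funext m; simp
  rw [h2, h3, mderiv_const, mderiv_id, mderiv_id] at h1
  exact eq_neg_of_add_eq_zero_left h1.symm

lemma _root_.SymmetryData.eq_zero_of_κ (Γ : SymmetryData EG G) {x : EG} (h : ∀ ξ, Γ.κ x ξ = 0) :
    x = 0 := by
  by_contra hx
  exact (Γ.κ_pos x hx).ne' (h x)

lemma kill_injective {m : M} (hs : Function.Surjective (T.dμ m)) :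
    Function.Injective (T.kill m) := by
  rw [injective_iff_map_eq_zero]
  intro ξ hξ
  obtain ⟨v, hv⟩ := hs fun _ => ξ
  by_contra hne
  have h1 := T.κ_dμ 0 m v ξ
  rw [hξ, map_zero, map_zero, hv] at h1
  exact (Γ.κ_pos ξ hne).ne' h1

/-- The adjoint of the infinitesimal action with respect to the metrics on `M` and `ℒ`. The moment
map provides it in the form `v ↦ dμ₁ (I₁ v)`, which makes its smoothness evident. -/
def killAdjoint (m : M) : EM →L[ℝ] EG :=
  (ContinuousLinearMap.proj (R := ℝ) (φ := fun _ : Fin 3 => EG) 0).comp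
    ((T.dμ m).comp (T.hk.cplx m 0))

lemma killAdjoint_apply (m : M) (v : EM) : T.killAdjoint m v = T.dμ m (T.hk.cplx m 0 v) 0 := rfl

lemma κ_killAdjoint (m : M) (v : EM) (ξ : EG) :
    Γ.κ (T.killAdjoint m v) ξ = T.hk.metric m (T.kill m ξ) v := by
  rw [killAdjoint_apply, κ_dμ, HyperKahler.metric_cplx_cplx]

/-- The Gram operator of the Killing vectors at `m`: the operator on `ℒ` which represents the
bilinear form `(ξ, η) ↦ g (K_ξ, K_η)`. -/
def gram (m : M) : EG →L[ℝ] EG := (T.killAdjoint m).comp (T.kill m)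

lemma gram_isInvertible [FiniteDimensional ℝ EG] {m : M} (hs : Function.Surjective (T.dμ m)) :
    (T.gram m).IsInvertible := by
  have hinj : Function.Injective (T.gram m : EG →ₗ[ℝ] EG) := by
    rw [injective_iff_map_eq_zero]
    intro ξ hξ
    refine (injective_iff_map_eq_zero _).1 (T.kill_injective hs) ξ ?_
    refine T.hk.eq_zero_of_metric_self m ?_
    rw [← κ_killAdjoint, show T.killAdjoint m (T.kill m ξ) = 0 from hξ]
    simp
  exact ⟨(LinearEquiv.ofInjectiveEndo _ hinj).toContinuousLinearEquiv, by ext; rfl⟩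

/-- The coefficient of the orthogonal projection to the Killing vectors: `v ↦ ξ` where `v - K_ξ` is
orthogonal to all Killing vectors. -/
def conn (m : M) : EM →L[ℝ] EG := (T.gram m).inverse.comp (T.killAdjoint m)

lemma gram_conn [FiniteDimensional ℝ EG] {m : M} (hs : Function.Surjective (T.dμ m)) (v : EM) :
    T.killAdjoint m (T.kill m (T.conn m v)) = T.killAdjoint m v :=
  (T.gram_isInvertible hs).self_apply_inverse _

lemma conn_unique [FiniteDimensional ℝ EG] {m : M} (hs : Function.Surjective (T.dμ m)) {v : EM}
    {η : EG} (h : ∀ ξ, T.hk.metric m (T.kill m ξ) (v - T.kill m η) = 0) : T.conn m v = η := by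
  have h1 : T.killAdjoint m (v - T.kill m η) = 0 :=
    Γ.eq_zero_of_κ fun ξ => by rw [κ_killAdjoint, h]
  rw [map_sub, sub_eq_zero] at h1
  change (T.gram m).inverse (T.killAdjoint m v) = η
  rw [h1]
  exact (T.gram_isInvertible hs).inverse_apply_self _

lemma conn_kill [FiniteDimensional ℝ EG] {m : M} (hs : Function.Surjective (T.dμ m)) (ξ : EG) :
    T.conn m (T.kill m ξ) = ξ :=
  T.conn_unique hs fun η => by rw [sub_self, map_zero]

lemma metric_kill_sub [FiniteDimensional ℝ EG] {m : M} (hs : Function.Surjective (T.dμ m)) (v : EM)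
    (ξ : EG) : T.hk.metric m (T.kill m ξ) (v - T.kill m (T.conn m v)) = 0 := by
  rw [← κ_killAdjoint, map_sub, T.gram_conn hs, sub_self, map_zero]
  rfl

lemma conn_dactSp [FiniteDimensional ℝ EG] {m : M} (hs : Function.Surjective (T.dμ m)) (q : Sp1)
    (hs' : Function.Surjective (T.dμ (T.actSp q m))) (v : EM) :
    T.conn (T.actSp q m) (T.dactSp q m v) = Γ.dα q (T.conn m v) := by
  refine T.conn_unique hs' fun ξ => ?_
  obtain ⟨η, hη⟩ := T.exists_kill_actSp q m ξ
  rw [hη, ← dactSp_kill, ← map_sub, metric_dactSp, T.metric_kill_sub hs]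

/-- A vector tangent to the zero level minus its Killing part is horizontal. -/
lemma isHorizontal_sub [FiniteDimensional ℝ EG] {m : M} (hm : T.μ m = 0)
    (hs : Function.Surjective (T.dμ m)) {v : EM} (hv : T.dμ m v = 0) :
    T.IsHorizontal m (v - T.kill m (T.conn m v) : EM) := by
  rw [isHorizontal_iff]
  intro ξ
  refine ⟨T.metric_kill_sub hs v ξ, fun l => ?_⟩
  rw [← κ_dμ, map_sub, hv, T.dμ_kill hm, sub_zero, Pi.zero_apply, map_zero]
  rfl

lemma IsHorizontal.dμ_eq_zero {m : M} {v : EM} (hv : T.IsHorizontal m v) : T.dμ m v = 0 := by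
  rw [isHorizontal_iff] at hv
  funext l
  exact Γ.eq_zero_of_κ fun ξ => by rw [κ_dμ, (hv ξ).2]

lemma IsHorizontal.eq_zero_of_kill {m : M} {ξ : EG}
    (hv : T.IsHorizontal m (T.kill m ξ : EM)) : T.kill m ξ = 0 :=
  T.hk.eq_zero_of_metric_self m ((T.isHorizontal_iff.1 hv ξ).1)

lemma IsHorizontal.sub {m : M} {v w : EM} (hv : T.IsHorizontal m v) (hw : T.IsHorizontal m w) :
    T.IsHorizontal m (v - w : EM) := by
  rw [isHorizontal_iff] at *
  intro ξ
  refine ⟨?_, fun l => ?_⟩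
  · rw [map_sub, (hv ξ).1, (hw ξ).1, sub_zero]
  · rw [map_sub, (hv ξ).2, (hw ξ).2, sub_zero]

/-- If `x₀ = ∑ I_l x_l` with all vectors tangent to the zero level, then `x₀` has no Killing part:
`I_l x_l` is orthogonal to the Killing vectors because `dμ_l x_l = 0`. -/
lemma conn_eq_zero_of_eq_sum [FiniteDimensional ℝ EG] {m : M}
    (hs : Function.Surjective (T.dμ m)) {x₀ : EM} {x : Fin 3 → EM} (hx : ∀ l, T.dμ m (x l) = 0)
    (h : x₀ = ∑ l, T.hk.cplx m l (x l)) : T.conn m x₀ = 0 := by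
  refine T.conn_unique hs fun ξ => ?_
  rw [map_zero, sub_zero, h, map_sum]
  refine Finset.sum_eq_zero fun l _ => ?_
  rw [HyperKahler.metric_cplx_right, ← κ_dμ, hx, Pi.zero_apply, map_zero]
  simp

section Reduced

variable {EN : Type*} [NormedAddCommGroup EN] [NormedSpace ℝ EN] [ChartedSpace EN T.Level]
  {E0 : Type*} [NormedAddCommGroup E0] [NormedSpace ℝ E0] [ChartedSpace E0 T.Reduction]

variable (EN) in
/-- The differential of the inclusion of the zero level. -/
def dval (n : T.Level) : EN →L[ℝ] EM := mderiv 𝓘(ℝ, EN) 𝓘(ℝ, EM) (Subtype.val : T.Level → M) n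

variable (EN E0) in
/-- The differential of the projection to the reduction. -/
def dred (n : T.Level) : EN →L[ℝ] E0 := mderiv 𝓘(ℝ, EN) 𝓘(ℝ, E0) T.toReduction n

/-- A continuous map to the zero level that is smooth as a map to `M` is smooth. -/
lemma contMDiffAt_level
    (hN : Manifold.IsSmoothEmbedding 𝓘(ℝ, EN) 𝓘(ℝ, EM) ∞ (Subtype.val : T.Level → M))
    [IsManifold 𝓘(ℝ, EN) ∞ T.Level]
    {E' : Type*} [NormedAddCommGroup E'] [NormedSpace ℝ E'] {N : Type*} [TopologicalSpace N]
    [ChartedSpace E' N] [IsManifold 𝓘(ℝ, E') ∞ N] {h : N → T.Level} {x : N}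
    (hh : ContMDiffAt 𝓘(ℝ, E') 𝓘(ℝ, EM) ∞ (fun y => (h y : M)) x) :
    ContMDiffAt 𝓘(ℝ, E') 𝓘(ℝ, EN) ∞ h x :=
  (ContMDiffAt.iff_comp_isImmersionAt (hN.isImmersion.isImmersionAt (h x))).2
    ⟨hN.isEmbedding.isInducing.continuousAt_iff.2 hh.continuousAt, hh⟩

lemma dval_injective [IsManifold 𝓘(ℝ, EN) ∞ T.Level]
    (hN : Manifold.IsSmoothEmbedding 𝓘(ℝ, EN) 𝓘(ℝ, EM) ∞ (Subtype.val : T.Level → M))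
    (n : T.Level) : Function.Injective (T.dval EN n) :=
  (hN.isImmersion.isImmersionAt n).mderiv_injective

/-- The tangent space of a regular zero level is the whole kernel of `dμ`. -/
lemma exists_dval_eq [FiniteDimensional ℝ EG] [FiniteDimensional ℝ EM]
    [IsManifold 𝓘(ℝ, EN) ∞ T.Level]
    (hN : Manifold.IsSmoothEmbedding 𝓘(ℝ, EN) 𝓘(ℝ, EM) ∞ (Subtype.val : T.Level → M))
    {n : T.Level} (hs : Function.Surjective (T.dμ n.1)) {x : EM} (hx : T.dμ n.1 x = 0) :
    ∃ v, T.dval EN n v = x := by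
  classical
  obtain ⟨γ, hγ, hγ0, hγd, hγμ⟩ := exists_curve_of_surjective_mfderiv T.smooth_μ.contMDiffAt n.2
    hs hx
  let h : ℝ → T.Level := fun t => if ht : T.μ (γ t) = 0 then ⟨γ t, ht⟩ else n
  have hev : (fun t => (h t : M)) =ᶠ[𝓝 0] γ := by
    filter_upwards [hγμ] with t ht
    simp [h, ht]
  have hh : ContMDiffAt 𝓘(ℝ, ℝ) 𝓘(ℝ, EN) ∞ h 0 :=
    T.contMDiffAt_level hN (hγ.congr_of_eventuallyEq hev)
  have h0 : h 0 = n := Subtype.ext (hev.eq_of_nhds.trans hγ0)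
  refine ⟨mderiv 𝓘(ℝ, ℝ) 𝓘(ℝ, EN) h 0 1, ?_⟩
  unfold dval
  rw [← mderiv_comp (hN.contMDiff.mdifferentiableAt (by simp)) (hh.mdifferentiableAt (by simp)) h0,
    ← hγd]
  exact DFunLike.congr_fun (mderiv_congr hev) 1

/-- The kernel of the differential of the projection to the reduction consists of the Killing
vectors; these are vectors of the model space of `M`, hence the inclusion `T.dval`. -/
lemma dred_eq_zero_iff [FiniteDimensional ℝ EG] [FiniteDimensional ℝ EM] [LieGroup 𝓘(ℝ, EG) ∞ G]
    [IsManifold 𝓘(ℝ, EN) ∞ T.Level]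
    (hN : Manifold.IsSmoothEmbedding 𝓘(ℝ, EN) 𝓘(ℝ, EM) ∞ (Subtype.val : T.Level → M))
    (hM₀ : IsPrincipalBundle (EB := E0) (EP := EN) 𝓘(ℝ, EG) T.toReduction T.levelAct)
    (n : T.Level) (v : EN) : T.dred EN E0 n v = 0 ↔ ∃ ξ, T.dval EN n v = T.kill n.1 ξ := by
  have hv : ∀ ξ, T.dval EN n (mderiv 𝓘(ℝ, EG) 𝓘(ℝ, EN) (fun a => T.levelAct n a) 1 ξ) =
      -T.kill n.1 ξ := by
    intro ξ
    unfold dval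
    rw [← mderiv_comp (hN.contMDiff.mdifferentiableAt (by simp))
      ((hM₀.smooth_act_right n).mdifferentiableAt (by simp)) (hM₀.act_one n)]
    exact T.mderiv_actG_inv n.1 ξ
  constructor
  · intro h
    obtain ⟨ξ, hξ⟩ := hM₀.exists_vertical (fun s => contMDiff_mul_left) n h
    refine ⟨-ξ, ?_⟩
    rw [← hξ, hv, map_neg]
  · rintro ⟨ξ, hξ⟩
    have h1 := T.dval_injective hN n (a₁ := v)
      (a₂ := mderiv 𝓘(ℝ, EG) 𝓘(ℝ, EN) (fun a => T.levelAct n a) 1 (-ξ))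
      (by rw [hv, hξ, map_neg, neg_neg])
    rw [h1]
    exact hM₀.mderiv_proj_vertical n _

end Reduced

end Target

/-! ### The complex structures of the reduction -/

namespace Target

variable {EG : Type*} [NormedAddCommGroup EG] [NormedSpace ℝ EG]
  {G : Type*} [TopologicalSpace G] [ChartedSpace EG G] [Group G]
  {EM : Type*} [NormedAddCommGroup EM] [NormedSpace ℝ EM]
  {M : Type*} [TopologicalSpace M] [ChartedSpace EM M] [IsManifold 𝓘(ℝ, EM) ∞ M]
  {Γ : SymmetryData EG G} (T : Target EM M Γ)
  {EN : Type*} [NormedAddCommGroup EN] [NormedSpace ℝ EN] [ChartedSpace EN T.Level]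
  {E0 : Type*} [NormedAddCommGroup E0] [NormedSpace ℝ E0] [ChartedSpace E0 T.Reduction]

/-- On horizontal vectors the differential of the projection to the reduction is injective. -/
lemma eq_zero_of_dred_eq_zero [FiniteDimensional ℝ EG] [LieGroup 𝓘(ℝ, EG) ∞ G]
    [FiniteDimensional ℝ EM] [IsManifold 𝓘(ℝ, EN) ∞ T.Level]
    (hN : Manifold.IsSmoothEmbedding 𝓘(ℝ, EN) 𝓘(ℝ, EM) ∞ (Subtype.val : T.Level → M))
    (hM₀ : IsPrincipalBundle (EB := E0) (EP := EN) 𝓘(ℝ, EG) T.toReduction T.levelAct)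
    {n : T.Level} {v : EN} (hv : T.IsHorizontal n.1 (T.dval EN n v : EM))
    (h : T.dred EN E0 n v = 0) : v = 0 := by
  obtain ⟨ξ, hξ⟩ := (T.dred_eq_zero_iff hN hM₀ n v).1 h
  rw [hξ] at hv
  refine T.dval_injective hN n ?_
  rw [hξ, IsHorizontal.eq_zero_of_kill T hv, map_zero]

/-- The action of `𝒢` transports horizontal vectors between the points over a point of the
reduction. -/
lemma exists_transport
    (hN : Manifold.IsSmoothEmbedding 𝓘(ℝ, EN) 𝓘(ℝ, EM) ∞ (Subtype.val : T.Level → M))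
    (hM₀ : IsPrincipalBundle (EB := E0) (EP := EN) 𝓘(ℝ, EG) T.toReduction T.levelAct)
    {n n₀ : T.Level} (hn : T.toReduction n = T.toReduction n₀) :
    ∃ (a : G) (ρ : EN →L[ℝ] EN), T.actG a n.1 = n₀.1 ∧
      (∀ v, T.dval EN n₀ (ρ v) = T.dactG a n.1 (T.dval EN n v)) ∧
      ∀ v, T.dred EN E0 n₀ (ρ v) = T.dred EN E0 n v := by
  obtain ⟨b, rfl⟩ := hM₀.exists_act_eq hn
  have hb : MDifferentiableAt 𝓘(ℝ, EN) 𝓘(ℝ, EN) (fun n => T.levelAct n b) n :=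
    (hM₀.smooth_act_left b).mdifferentiableAt (by simp)
  refine ⟨b⁻¹, mderiv 𝓘(ℝ, EN) 𝓘(ℝ, EN) (fun n => T.levelAct n b) n, rfl, fun v => ?_, fun v => ?_⟩
  · unfold dval dactG
    rw [← mderiv_comp (hN.contMDiff.mdifferentiableAt (by simp)) hb rfl,
      ← mderiv_comp ((T.smooth_actG_left _).mdifferentiableAt (by simp))
        (hN.contMDiff.mdifferentiableAt (by simp)) rfl]
    rfl
  · unfold dred
    rw [← mderiv_comp (hM₀.smooth_proj.mdifferentiableAt (by simp)) hb rfl]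
    simp only [hM₀.proj_act]

/-- Transport through the isomorphism `H_n ≅ T_y M₀` at one point `n` over `y` gives an endomorphism
that corresponds to `I l` at all points over `y`, because `𝒢` preserves `I l` and `H`. -/
lemma exists_isReducedComplexStructure [FiniteDimensional ℝ EG] [LieGroup 𝓘(ℝ, EG) ∞ G]
    [FiniteDimensional ℝ EM] [IsManifold 𝓘(ℝ, EN) ∞ T.Level] [FiniteDimensional ℝ E0]
    (hN : Manifold.IsSmoothEmbedding 𝓘(ℝ, EN) 𝓘(ℝ, EM) ∞ (Subtype.val : T.Level → M))
    (hM₀ : IsPrincipalBundle (EB := E0) (EP := EN) 𝓘(ℝ, EG) T.toReduction T.levelAct)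
    (l : Fin 3) (y : T.Reduction) : ∃ J, T.IsReducedComplexStructure (E0 := E0) EN l y J := by
  obtain ⟨n₀, rfl⟩ := hM₀.surjective y
  let H : Submodule ℝ EN :=
    { carrier := {v | T.IsHorizontal n₀.1 (T.dval EN n₀ v : EM)}
      zero_mem' := by
        change T.IsHorizontal n₀.1 (T.dval EN n₀ 0 : EM)
        rw [map_zero, isHorizontal_iff]; simp
      add_mem' := by
        intro v w hv hw
        change T.IsHorizontal n₀.1 (T.dval EN n₀ (v + w) : EM)
        have hv := T.isHorizontal_iff.1 hv
        have hw := T.isHorizontal_iff.1 hw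
        rw [isHorizontal_iff]
        intro ξ
        simp [(hv ξ).1, (hw ξ).1, (hv ξ).2, (hw ξ).2]
      smul_mem' := by
        intro c v hv
        change T.IsHorizontal n₀.1 (T.dval EN n₀ (c • v) : EM)
        have hv := T.isHorizontal_iff.1 hv
        rw [isHorizontal_iff]
        intro ξ
        simp [(hv ξ).1, (hv ξ).2] }
  -- left inverses of the differential of the inclusion and of `H → T_y M₀`
  obtain ⟨D, hD⟩ := LinearMap.exists_leftInverse_of_injective
    (T.dval EN n₀ : EN →ₗ[ℝ] EM) (LinearMap.ker_eq_bot.2 (T.dval_injective hN n₀))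
  obtain ⟨R, hR⟩ := LinearMap.exists_leftInverse_of_injective
    ((T.dred EN E0 n₀ : EN →ₗ[ℝ] E0) ∘ₗ H.subtype) (by
      rw [LinearMap.ker_eq_bot']
      intro v hv
      exact Subtype.ext (T.eq_zero_of_dred_eq_zero hN hM₀ v.2 hv))
  let J : E0 →L[ℝ] E0 := LinearMap.toContinuousLinearMap
    ((T.dred EN E0 n₀ : EN →ₗ[ℝ] E0) ∘ₗ D ∘ₗ (T.hk.cplx n₀.1 l : EM →ₗ[ℝ] EM) ∘ₗ
      (T.dval EN n₀ : EN →ₗ[ℝ] EM) ∘ₗ H.subtype ∘ₗ R)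
  have hJ : ∀ v w : EN, T.IsHorizontal n₀.1 (T.dval EN n₀ v : EM) →
      T.dval EN n₀ w = T.hk.cplx n₀.1 l (T.dval EN n₀ v) →
      J (T.dred EN E0 n₀ v) = T.dred EN E0 n₀ w := by
    intro v w hv hw
    have h1 : R (T.dred EN E0 n₀ v) = ⟨v, hv⟩ := DFunLike.congr_fun hR (⟨v, hv⟩ : H)
    change T.dred EN E0 n₀ (D (T.hk.cplx n₀.1 l (T.dval EN n₀ (R (T.dred EN E0 n₀ v) : EN)))) = _
    rw [h1, ← hw]
    exact congrArg _ (DFunLike.congr_fun hD w)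
  have key : ∀ n : T.Level, T.toReduction n = T.toReduction n₀ → ∀ v w : EN,
      T.IsHorizontal n.1 (T.dval EN n v : EM) → T.dval EN n w = T.hk.cplx n.1 l (T.dval EN n v) →
      J (T.dred EN E0 n v) = T.dred EN E0 n w := by
    intro n hn v w hv hw
    obtain ⟨a, ρ, ha, hρ, hρ'⟩ := T.exists_transport hN hM₀ hn
    rw [← hρ', ← hρ']
    refine hJ _ _ ?_ ?_
    · rw [hρ, ← ha]
      exact IsHorizontal.dactG T hv a
    · rw [hρ, hρ, ← ha, hw, dactG_cplx]
  exact ⟨J, key⟩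

/-- The complex structures of the reduction are induced by those of `M` on the horizontal vectors;
so `T.redI` is never given by its default value `0`. -/
lemma redI_dred [FiniteDimensional ℝ EG] [LieGroup 𝓘(ℝ, EG) ∞ G]
    [FiniteDimensional ℝ EM] [IsManifold 𝓘(ℝ, EN) ∞ T.Level] [FiniteDimensional ℝ E0]
    (hN : Manifold.IsSmoothEmbedding 𝓘(ℝ, EN) 𝓘(ℝ, EM) ∞ (Subtype.val : T.Level → M))
    (hM₀ : IsPrincipalBundle (EB := E0) (EP := EN) 𝓘(ℝ, EG) T.toReduction T.levelAct)
    (l : Fin 3) (n : T.Level) {y : T.Reduction} (hy : T.toReduction n = y)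
    {v w : EN} (hv : T.IsHorizontal n.1 (T.dval EN n v : EM))
    (hw : T.dval EN n w = T.hk.cplx n.1 l (T.dval EN n v)) :
    T.redI EN E0 l y (T.dred EN E0 n v : E0) = (T.dred EN E0 n w : E0) := by
  have h := T.exists_isReducedComplexStructure hN hM₀ l y
  rw [redI, dif_pos h]
  exact Classical.choose_spec h n hy v w hv hw

end Target

/-! ### Sections of associated bundles and their projection to the reduction -/

namespace SpinStructure

variable {X : Type*} [TopologicalSpace X] [ChartedSpace E4 X] [IsManifold 𝓘(ℝ, E4) ∞ X]
  {g : ContMDiffRiemannianMetric 𝓘(ℝ, E4) ∞ E4 (fun x : X => TangentSpace 𝓘(ℝ, E4) x)}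
  {o : ∀ x : X, Orientation ℝ (TangentSpace 𝓘(ℝ, E4) x) (Fin 4)}
  {EQ : Type*} [NormedAddCommGroup EQ] [NormedSpace ℝ EQ]
  {Q : Type*} [TopologicalSpace Q] [ChartedSpace EQ Q] [IsManifold 𝓘(ℝ, EQ) ∞ Q]
  {P : SpinStructure g o EQ Q} {F : Type*} {act : Sp1 →* Equiv.Perm F}

lemma Assoc.mk_right_injective {f : Q} {m m' : F} (h : Assoc.mk P act f m = Assoc.mk P act f m') :
    m = m' := by
  obtain ⟨s, h1, h2⟩ := Quotient.exact h
  have hs : s = 1 := P.principal.free f s h1.symm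
  subst hs
  simpa using h2.symm

lemma Assoc.mk_r (f : Q) (m : F) (s : Spin4) :
    Assoc.mk P act (P.r f s) (act s.1⁻¹ m) = Assoc.mk P act f m :=
  (Quotient.sound (s := P.assocSetoid act) ⟨s, rfl, rfl⟩).symm

variable {EF : Type*} [NormedAddCommGroup EF] [NormedSpace ℝ EF] [TopologicalSpace F]
  [ChartedSpace EF F]

namespace Section

variable (u : P.Section EF act)

lemma contMDiff_equivariantMap : ContMDiff 𝓘(ℝ, EQ) 𝓘(ℝ, EF) ∞ u.equivariantMap :=
  (Classical.choose_spec u.smooth).1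

lemma toFun_proj (f : Q) : u.toFun (P.proj f) = Assoc.mk P act f (u.equivariantMap f) :=
  (Classical.choose_spec u.smooth).2 f

lemma equivariantMap_eq {f : Q} {m : F} (h : u.toFun (P.proj f) = Assoc.mk P act f m) :
    u.equivariantMap f = m :=
  Assoc.mk_right_injective ((u.toFun_proj f).symm.trans h)

lemma equivariantMap_r (f : Q) (s : Spin4) :
    u.equivariantMap (P.r f s) = act s.1⁻¹ (u.equivariantMap f) := by
  refine u.equivariantMap_eq ?_
  rw [Assoc.mk_r, P.principal.proj_act, u.toFun_proj]

lemma ext_toFun {u v : P.Section EF act} (h : ∀ x, u.toFun x = v.toFun x) : u = v := by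
  obtain ⟨a, _, _⟩ := u
  obtain ⟨b, _, _⟩ := v
  obtain rfl : a = b := funext h
  rfl

/-- The section represented by a smooth equivariant map on `Q`. -/
def ofEquivariantMap (h : Q → F) (hs : ContMDiff 𝓘(ℝ, EQ) 𝓘(ℝ, EF) ∞ h)
    (he : ∀ f (s : Spin4), h (P.r f s) = act s.1⁻¹ (h f)) : P.Section EF act :=
  have key : ∀ f, Assoc.mk P act (Classical.choose (P.principal.surjective (P.proj f)))
      (h (Classical.choose (P.principal.surjective (P.proj f)))) = Assoc.mk P act f (h f) := by
    intro f
    obtain ⟨s, hs⟩ := P.principal.exists_act_eq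
      (Classical.choose_spec (P.principal.surjective (P.proj f)))
    conv_rhs => rw [← hs, he, Assoc.mk_r]
  { toFun := fun x => Assoc.mk P act (Classical.choose (P.principal.surjective x))
      (h (Classical.choose (P.principal.surjective x)))
    isSection := fun x => Classical.choose_spec (P.principal.surjective x)
    smooth := ⟨h, hs, key⟩ }

lemma equivariantMap_ofEquivariantMap (h : Q → F) (hs : ContMDiff 𝓘(ℝ, EQ) 𝓘(ℝ, EF) ∞ h)
    (he : ∀ f (s : Spin4), h (P.r f s) = act s.1⁻¹ (h f)) (f : Q) :
    (ofEquivariantMap (P := P) h hs he).equivariantMap f = h f := by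
  refine equivariantMap_eq _ ?_
  obtain ⟨s, hs⟩ := P.principal.exists_act_eq
    (Classical.choose_spec (P.principal.surjective (P.proj f)))
  conv_rhs => rw [← hs, he, Assoc.mk_r]
  rfl

end Section

end SpinStructure

section Projection

variable {X : Type*} [TopologicalSpace X] [ChartedSpace E4 X] [IsManifold 𝓘(ℝ, E4) ∞ X]
  {g : ContMDiffRiemannianMetric 𝓘(ℝ, E4) ∞ E4 (fun x : X => TangentSpace 𝓘(ℝ, E4) x)}
  {o : ∀ x : X, Orientation ℝ (TangentSpace 𝓘(ℝ, E4) x) (Fin 4)}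
  {EQ : Type*} [NormedAddCommGroup EQ] [NormedSpace ℝ EQ]
  {Q : Type*} [TopologicalSpace Q] [ChartedSpace EQ Q] [IsManifold 𝓘(ℝ, EQ) ∞ Q]
  {P : SpinStructure g o EQ Q}
  {EG : Type*} [NormedAddCommGroup EG] [NormedSpace ℝ EG]
  {G : Type*} [TopologicalSpace G] [ChartedSpace EG G] [Group G]
  {EM : Type*} [NormedAddCommGroup EM] [NormedSpace ℝ EM]
  {M : Type*} [TopologicalSpace M] [ChartedSpace EM M] [IsManifold 𝓘(ℝ, EM) ∞ M]
  {Γ : SymmetryData EG G} {T : Target EM M Γ}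
  {EN : Type*} [NormedAddCommGroup EN] [NormedSpace ℝ EN] [ChartedSpace EN T.Level]
  {E0 : Type*} [NormedAddCommGroup E0] [NormedSpace ℝ E0] [ChartedSpace E0 T.Reduction]
  {u : P.Section EM T.actSp}

lemma NuVanishes.μ_equivariantMap (hu : NuVanishes T u) (f : Q) : T.μ (u.equivariantMap f) = 0 := by
  have h := hu f
  rw [u.toFun_proj] at h
  exact SpinStructure.Assoc.mk_right_injective (P := P) (act := Γ.imAct) h

/-- The equivariant map of a section annihilated by `ν`, as a map to the zero level. -/
def NuVanishes.levelMap (hu : NuVanishes T u) (f : Q) : T.Level :=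
  ⟨u.equivariantMap f, hu.μ_equivariantMap f⟩

lemma NuVanishes.contMDiff_levelMap (hu : NuVanishes T u) [IsManifold 𝓘(ℝ, EN) ∞ T.Level]
    (hN : Manifold.IsSmoothEmbedding 𝓘(ℝ, EN) 𝓘(ℝ, EM) ∞ (Subtype.val : T.Level → M)) :
    ContMDiff 𝓘(ℝ, EQ) 𝓘(ℝ, EN) ∞ hu.levelMap := fun f =>
  T.contMDiffAt_level hN (h := hu.levelMap) (u.contMDiff_equivariantMap f)

lemma NuVanishes.toReduction_levelMap_r (hu : NuVanishes T u) (f : Q) (s : Spin4) :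
    T.toReduction (hu.levelMap (P.r f s)) = T.redAct s.1⁻¹ (T.toReduction (hu.levelMap f)) := by
  have h : hu.levelMap (P.r f s) = ⟨T.actSp s.1⁻¹ (hu.levelMap f).1, T.μ_actSp (hu.levelMap f) _⟩ :=
    Subtype.ext (u.equivariantMap_r f s)
  rw [h]
  rfl

lemma isProjection_iff (hu : NuVanishes T u) (v : P.Section E0 T.redAct) :
    IsProjection T u v ↔ ∀ f, v.equivariantMap f = T.toReduction (hu.levelMap f) := by
  constructor
  · intro h f
    exact v.equivariantMap_eq (h f (hu.levelMap f) (u.toFun_proj f))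
  · intro h f n hn
    have h1 : hu.levelMap f = n := Subtype.ext (u.equivariantMap_eq hn)
    rw [v.toFun_proj, h, h1]

lemma existsUnique_isProjection (hu : NuVanishes T u) [IsManifold 𝓘(ℝ, EN) ∞ T.Level]
    (hN : Manifold.IsSmoothEmbedding 𝓘(ℝ, EN) 𝓘(ℝ, EM) ∞ (Subtype.val : T.Level → M))
    (hM₀ : IsPrincipalBundle (EB := E0) (EP := EN) 𝓘(ℝ, EG) T.toReduction T.levelAct) :
    ∃! v : P.Section E0 T.redAct, IsProjection T u v := by
  simp only [isProjection_iff hu]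
  refine ⟨.ofEquivariantMap (fun f => T.toReduction (hu.levelMap f))
    (hM₀.smooth_proj.comp (hu.contMDiff_levelMap hN)) hu.toReduction_levelMap_r,
    SpinStructure.Section.equivariantMap_ofEquivariantMap _ _ _, fun v hv => ?_⟩
  refine SpinStructure.Section.ext_toFun fun x => ?_
  obtain ⟨f, rfl⟩ := P.principal.surjective x
  rw [v.toFun_proj, SpinStructure.Section.toFun_proj,
    SpinStructure.Section.equivariantMap_ofEquivariantMap, hv]

end Projection

/-! ### Smoothness of differentials and of operator-valued maps -/

section Smoothness

variable {E₁ : Type*} [NormedAddCommGroup E₁] [NormedSpace ℝ E₁] {H₁ : Type*} [TopologicalSpace H₁]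
  {I₁ : ModelWithCorners ℝ E₁ H₁} {M₁ : Type*} [TopologicalSpace M₁] [ChartedSpace H₁ M₁]
  {E₂ : Type*} [NormedAddCommGroup E₂] [NormedSpace ℝ E₂] {H₂ : Type*} [TopologicalSpace H₂]
  {I₂ : ModelWithCorners ℝ E₂ H₂} {M₂ : Type*} [TopologicalSpace M₂] [ChartedSpace H₂ M₂]
  {E₃ : Type*} [NormedAddCommGroup E₃] [NormedSpace ℝ E₃] {H₃ : Type*} [TopologicalSpace H₃]
  {I₃ : ModelWithCorners ℝ E₃ H₃} {M₃ : Type*} [TopologicalSpace M₃] [ChartedSpace H₃ M₃]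
  {V W : Type*} [NormedAddCommGroup V] [NormedSpace ℝ V] [NormedAddCommGroup W] [NormedSpace ℝ W]

/-- A tangent vector given by a base point and a vector of the model space. -/
abbrev tangentPoint (I₁ : ModelWithCorners ℝ E₁ H₁) {M₁ : Type*} [TopologicalSpace M₁]
    [ChartedSpace H₁ M₁] (x : M₁) (v : E₁) : TangentBundle I₁ M₁ := ⟨x, v⟩

lemma contMDiff_mderiv_vector [IsManifold I₁ ∞ M₁] {h : M₁ → V}
    (hh : ContMDiff I₁ 𝓘(ℝ, V) ∞ h) :
    ContMDiff I₁.tangent 𝓘(ℝ, V) ∞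
      (fun w : TangentBundle I₁ M₁ => mderiv I₁ 𝓘(ℝ, V) h w.1 w.2) := by
  have : IsManifold I₁ 1 M₁ := .of_le (n := ∞) (by simp)
  exact (contMDiff_snd_tangentBundle_modelSpace V 𝓘(ℝ, V)).comp
    (hh.contMDiff_tangentMap (m := ∞) (by simp))

/-- The pull-back of a smooth vector-valued 1-form is smooth. -/
lemma contMDiff_comp_mderiv [IsManifold I₁ ∞ M₁] [IsManifold I₂ ∞ M₂] {K : M₂ → E₂ →L[ℝ] V}
    (hK : ContMDiff I₂.tangent 𝓘(ℝ, V) ∞ (fun w : TangentBundle I₂ M₂ => K w.1 w.2)) {h : M₁ → M₂}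
    (hh : ContMDiff I₁ I₂ ∞ h) :
    ContMDiff I₁.tangent 𝓘(ℝ, V) ∞
      (fun w : TangentBundle I₁ M₁ => K (h w.1) (mderiv I₁ I₂ h w.1 w.2)) := by
  have : IsManifold I₁ 1 M₁ := .of_le (n := ∞) (by simp)
  have : IsManifold I₂ 1 M₂ := .of_le (n := ∞) (by simp)
  exact hK.comp (hh.contMDiff_tangentMap (m := ∞) (by simp))

/-- The derivative of a function of two variables with respect to the second variable at a fixed
point in a fixed direction, as a vector along the map. -/
lemma contMDiff_mderiv_right [IsManifold I₁ ∞ M₁] [IsManifold I₂ ∞ M₂] [IsManifold I₃ ∞ M₃]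
    {Φ : M₁ → M₂ → M₃} (hΦ : ContMDiff (I₁.prod I₂) I₃ ∞ (fun p : M₁ × M₂ => Φ p.1 p.2))
    (y : M₂) (v : E₂) :
    ContMDiff I₁ I₃.tangent ∞
      (fun x => tangentPoint I₃ (Φ x y) (mderiv I₂ I₃ (Φ x) y v)) := by
  have : IsManifold I₁ 1 M₁ := .of_le (n := ∞) (by simp)
  have : IsManifold I₂ 1 M₂ := .of_le (n := ∞) (by simp)
  have : IsManifold I₃ 1 M₃ := .of_le (n := ∞) (by simp)
  have h1 : ContMDiff I₁ (I₁.tangent.prod I₂.tangent) ∞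
      (fun x => (tangentPoint I₁ x 0, tangentPoint I₂ y v)) :=
    (contMDiff_zeroSection ℝ (TangentSpace I₁ : M₁ → Type _)).prodMk contMDiff_const
  have h2 := (hΦ.contMDiff_tangentMap (m := ∞) (by simp)).comp
    (contMDiff_equivTangentBundleProd_symm.comp h1)
  convert h2 using 1
  funext x
  have h3 := mderiv_prod (Φ := Φ) (hΦ.mdifferentiableAt (x := (x, y)) (by simp)) 0 v
  rw [map_zero, zero_add] at h3
  exact congrArg (tangentPoint I₃ (Φ x y)) h3.symm

/-- A map to the continuous linear maps on a finite-dimensional space is smooth if its values are.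
-/
lemma contMDiff_clm_of_apply [FiniteDimensional ℝ V] {L : M₁ → V →L[ℝ] W}
    (h : ∀ v, ContMDiff I₁ 𝓘(ℝ, W) ∞ (fun x => L x v)) : ContMDiff I₁ 𝓘(ℝ, V →L[ℝ] W) ∞ L := by
  let b := Module.finBasis ℝ V
  have hL : L = fun x => ∑ i, ContinuousLinearMap.smulRightL ℝ V W
      (LinearMap.toContinuousLinearMap (b.coord i)) (L x (b i)) := by
    funext x
    ext v
    conv_lhs => rw [← b.sum_repr v, map_sum]
    simp
  rw [hL]
  refine contMDiff_finsetSum fun i _ => ?_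
  exact (ContinuousLinearMap.contMDiff _).comp (h (b i))

lemma contMDiff_inverse [CompleteSpace V] {L : M₁ → V →L[ℝ] V}
    (h : ContMDiff I₁ 𝓘(ℝ, V →L[ℝ] V) ∞ L) (hi : ∀ x, (L x).IsInvertible) :
    ContMDiff I₁ 𝓘(ℝ, V →L[ℝ] V) ∞ (fun x => (L x).inverse) := by
  intro x
  obtain ⟨e, he⟩ := hi x
  have h1 : ContDiffAt ℝ ∞ ContinuousLinearMap.inverse (L x) := he ▸ contDiffAt_map_inverse e
  exact h1.contMDiffAt.comp x (h x)

end Smoothness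

/-! ### The 1-form that makes the covariant derivative horizontal -/

section Form

variable {X : Type*} [TopologicalSpace X] [ChartedSpace E4 X] [IsManifold 𝓘(ℝ, E4) ∞ X]
  {g : ContMDiffRiemannianMetric 𝓘(ℝ, E4) ∞ E4 (fun x : X => TangentSpace 𝓘(ℝ, E4) x)}
  {o : ∀ x : X, Orientation ℝ (TangentSpace 𝓘(ℝ, E4) x) (Fin 4)}
  {EQ : Type*} [NormedAddCommGroup EQ] [NormedSpace ℝ EQ]
  {Q : Type*} [TopologicalSpace Q] [ChartedSpace EQ Q] [IsManifold 𝓘(ℝ, EQ) ∞ Q]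
  {P : SpinStructure g o EQ Q} (A : P.LeviCivita)
  {EG : Type*} [NormedAddCommGroup EG] [NormedSpace ℝ EG]
  {G : Type*} [TopologicalSpace G] [ChartedSpace EG G] [Group G]
  {EM : Type*} [NormedAddCommGroup EM] [NormedSpace ℝ EM]
  {M : Type*} [TopologicalSpace M] [ChartedSpace EM M] [IsManifold 𝓘(ℝ, EM) ∞ M]
  {Γ : SymmetryData EG G} {T : Target EM M Γ}

lemma Target.contMDiff_killAdjoint (T : Target EM M Γ) : ContMDiff 𝓘(ℝ, EM).tangent 𝓘(ℝ, EG) ∞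
    (fun w : TangentBundle 𝓘(ℝ, EM) M => T.killAdjoint w.1 w.2) := by
  have h1 := (contMDiff_mderiv_vector T.smooth_μ).comp (T.hk.smooth_I 0)
  exact (ContinuousLinearMap.contMDiff (ContinuousLinearMap.proj (R := ℝ)
    (φ := fun _ : Fin 3 => EG) 0)).comp h1

variable (u : P.Section EM T.actSp)

/-- The differential of the equivariant map of a section. -/
def SpinStructure.Section.dmap {EF F : Type*} [NormedAddCommGroup EF] [NormedSpace ℝ EF]
    [TopologicalSpace F] [ChartedSpace EF F] {act : Sp1 →* Equiv.Perm F}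
    (u : P.Section EF act) (f : Q) : EQ →L[ℝ] EF :=
  mderiv 𝓘(ℝ, EQ) 𝓘(ℝ, EF) u.equivariantMap f

lemma SpinStructure.Section.dmap_dr (f : Q) (s : Spin4) (w : EQ) :
    u.dmap (P.r f s) (P.dr f s w) = T.dactSp s.1⁻¹ (u.equivariantMap f) (u.dmap f w) := by
  unfold dmap SpinStructure.dr Target.dactSp
  rw [← mderiv_comp (u.contMDiff_equivariantMap.mdifferentiableAt (by simp))
      ((P.principal.smooth_act_left s).mdifferentiableAt (by simp)) rfl,
    ← mderiv_comp ((T.smooth_actSp_left _).mdifferentiableAt (by simp))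
      (u.contMDiff_equivariantMap.mdifferentiableAt (by simp)) rfl]
  simp only [u.equivariantMap_r]

lemma contMDiff_killAdjoint_dmap : ContMDiff 𝓘(ℝ, EQ).tangent 𝓘(ℝ, EG) ∞
    (fun w : TangentBundle 𝓘(ℝ, EQ) Q =>
      T.killAdjoint (u.equivariantMap w.1) (u.dmap w.1 w.2)) :=
  contMDiff_comp_mderiv T.contMDiff_killAdjoint u.contMDiff_equivariantMap

lemma contMDiff_killAdjoint_dmap_vert : ContMDiff 𝓘(ℝ, EQ)
    𝓘(ℝ, (EuclideanSpace ℝ (Fin 3) × EuclideanSpace ℝ (Fin 3)) →L[ℝ] EG) ∞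
    (fun f => (T.killAdjoint (u.equivariantMap f)).comp ((u.dmap f).comp (P.vert f))) := by
  refine contMDiff_clm_of_apply fun ζ => ?_
  have h := (contMDiff_killAdjoint_dmap u).comp
    (contMDiff_mderiv_right P.principal.smooth_act (1 : Spin4) ζ)
  convert h using 1
  funext f
  have h1 : tangentPoint 𝓘(ℝ, EQ) f (P.vert f ζ) =
      tangentPoint 𝓘(ℝ, EQ) (P.r f 1) (P.vert f ζ) := by rw [P.principal.act_one]
  exact congrArg (fun w : TangentBundle 𝓘(ℝ, EQ) Q =>
    T.killAdjoint (u.equivariantMap w.1) (u.dmap w.1 w.2)) h1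

lemma killAdjoint_dmap_hor (f : Q) (w : EQ) :
    T.killAdjoint (u.equivariantMap f) (u.dmap f (A.hor f w)) =
      T.killAdjoint (u.equivariantMap f) (u.dmap f w) -
        (T.killAdjoint (u.equivariantMap f)).comp ((u.dmap f).comp (P.vert f))
          (sp1Coord (A.fstForm f w), sp1Coord (A.sndForm f w)) := by
  rw [A.hor_apply, map_sub, map_sub]
  rfl

/-- Smoothness of the Killing part of `∇^φ u` before inversion of the Gram operator. The connection
form subtracts the vertical part of a vector, so the composition is an explicit combination of
smooth vector-valued forms. -/
lemma contMDiff_killAdjoint_dmap_hor : ContMDiff 𝓘(ℝ, EQ).tangent 𝓘(ℝ, EG) ∞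
    (fun w : TangentBundle 𝓘(ℝ, EQ) Q =>
      T.killAdjoint (u.equivariantMap w.1) (u.dmap w.1 (A.hor w.1 w.2))) := by
  have h1 := (contMDiff_killAdjoint_dmap_vert u).comp
    (contMDiff_proj (n := ∞) (IB := 𝓘(ℝ, EQ)) (F := EQ)
      (TangentSpace 𝓘(ℝ, EQ) : Q → Type _))
  have h2 : ContMDiff 𝓘(ℝ, EQ).tangent 𝓘(ℝ, EuclideanSpace ℝ (Fin 3) × EuclideanSpace ℝ (Fin 3)) ∞
      (fun w : TangentBundle 𝓘(ℝ, EQ) Q =>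
        (sp1Coord (A.fstForm w.1 w.2), sp1Coord (A.sndForm w.1 w.2))) :=
    (sp1Coord.contMDiff.comp A.smooth_φ).prodMk_space (sp1Coord.contMDiff.comp A.smooth_ψ)
  refine ((contMDiff_killAdjoint_dmap u).sub (h1.clm_apply h2)).congr fun w => ?_
  exact killAdjoint_dmap_hor A u w.1 w.2

lemma contMDiff_inverse_gram [FiniteDimensional ℝ EG]
    (hs : ∀ f, Function.Surjective (T.dμ (u.equivariantMap f))) [LieGroup 𝓘(ℝ, EG) ∞ G] :
    ContMDiff 𝓘(ℝ, EQ) 𝓘(ℝ, EG →L[ℝ] EG) ∞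
      (fun f => (T.gram (u.equivariantMap f)).inverse) := by
  have : CompleteSpace EG := FiniteDimensional.complete ℝ EG
  have : IsManifold 𝓘(ℝ, EG) ∞ G := ContMDiffMul.toIsManifold
  refine contMDiff_inverse (contMDiff_clm_of_apply fun ξ => ?_) fun f => T.gram_isInvertible (hs f)
  have hΦ : ContMDiff (𝓘(ℝ, EQ).prod 𝓘(ℝ, EG)) 𝓘(ℝ, EM) ∞
      (fun p : Q × G => T.actG p.2 (u.equivariantMap p.1)) :=
    T.smooth_actG.comp (contMDiff_snd.prodMk (u.contMDiff_equivariantMap.comp contMDiff_fst))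
  have h := T.contMDiff_killAdjoint.comp
    (contMDiff_mderiv_right (Φ := fun f a => T.actG a (u.equivariantMap f)) hΦ (1 : G) ξ)
  convert h using 1
  funext f
  have h1 : tangentPoint 𝓘(ℝ, EM) (u.equivariantMap f) (T.kill (u.equivariantMap f) ξ) =
      tangentPoint 𝓘(ℝ, EM) (T.actG 1 (u.equivariantMap f)) (T.kill (u.equivariantMap f) ξ) := by
    rw [map_one]; rfl
  exact congrArg (fun w : TangentBundle 𝓘(ℝ, EM) M => T.killAdjoint w.1 w.2) h1

lemma conn_dmap_hor_dr [FiniteDimensional ℝ EG]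
    (hs : ∀ f, Function.Surjective (T.dμ (u.equivariantMap f))) (f : Q) (s : Spin4) (w : EQ) :
    -(T.conn (u.equivariantMap (P.r f s))
      (u.dmap (P.r f s) (A.hor (P.r f s) (P.dr f s w)))) =
      Γ.dα s.1⁻¹ (-(T.conn (u.equivariantMap f) (u.dmap f (A.hor f w)))) := by
  rw [A.hor_dr, u.dmap_dr, u.equivariantMap_r, T.conn_dactSp (hs f) _
    (u.equivariantMap_r f s ▸ hs (P.r f s)), map_neg]

lemma conn_dmap_hor_eq_zero {f : Q} {w : EQ} (hw : P.dproj f w = 0) :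
    -(T.conn (u.equivariantMap f) (u.dmap f (A.hor f w))) = 0 := by
  rw [A.hor_eq_zero hw, map_zero, map_zero, neg_zero]

/-- The 1-form `b` for which `∇^B u` is orthogonal to the Killing vectors: minus the Killing
coefficient of the covariant derivative `∇^φ u`. -/
def horizontalForm [FiniteDimensional ℝ EG] [LieGroup 𝓘(ℝ, EG) ∞ G]
    (hs : ∀ f, Function.Surjective (T.dμ (u.equivariantMap f))) : LForm P Γ where
  toFun f := (-(T.conn (u.equivariantMap f)).comp ((u.dmap f).comp (A.hor f)) : EQ →L[ℝ] EG)
  smooth := by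
    have h1 := (contMDiff_inverse_gram u hs).comp
      (contMDiff_proj (n := ∞) (IB := 𝓘(ℝ, EQ)) (F := EQ)
      (TangentSpace 𝓘(ℝ, EQ) : Q → Type _))
    exact (h1.clm_apply (contMDiff_killAdjoint_dmap_hor A u)).neg
  horizontal f w hw := conn_dmap_hor_eq_zero A u hw
  equivariant f s w := conn_dmap_hor_dr A u hs f s w

end Form

/-! ### Comparison of the Dirac operators -/

section Comparison

variable {X : Type*} [TopologicalSpace X] [ChartedSpace E4 X] [IsManifold 𝓘(ℝ, E4) ∞ X]
  {g : ContMDiffRiemannianMetric 𝓘(ℝ, E4) ∞ E4 (fun x : X => TangentSpace 𝓘(ℝ, E4) x)}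
  {o : ∀ x : X, Orientation ℝ (TangentSpace 𝓘(ℝ, E4) x) (Fin 4)}
  {EQ : Type*} [NormedAddCommGroup EQ] [NormedSpace ℝ EQ]
  {Q : Type*} [TopologicalSpace Q] [ChartedSpace EQ Q] [IsManifold 𝓘(ℝ, EQ) ∞ Q]
  {P : SpinStructure g o EQ Q} (A : P.LeviCivita)
  {EG : Type*} [NormedAddCommGroup EG] [NormedSpace ℝ EG]
  {G : Type*} [TopologicalSpace G] [ChartedSpace EG G] [Group G]
  {EM : Type*} [NormedAddCommGroup EM] [NormedSpace ℝ EM]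
  {M : Type*} [TopologicalSpace M] [ChartedSpace EM M] [IsManifold 𝓘(ℝ, EM) ∞ M]
  {Γ : SymmetryData EG G} {T : Target EM M Γ}

/-- The quaternionic structure given by a frame, on the model space. -/
def SpinStructure.quat (P : SpinStructure g o EQ Q) (f : Q) (l : Fin 3) (v : E4) : E4 := P.J f l v

lemma SpinStructure.cliffordPart_eq_zero_iff {T : Type*} [AddCommGroup T] [Module ℝ T]
    (P : SpinStructure g o EQ Q) (f : Q) (I : Fin 3 → T → T) (A : E4 → T) (v : E4) :
    P.cliffordPart f I A v = 0 ↔ A v = ∑ l, I l (A (P.quat f l v)) := by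
  unfold cliffordPart
  rw [smul_eq_zero_iff_right (by norm_num), sub_eq_zero]
  rfl

/-- The covariant derivative `∇^φ u` of a section, with values in the model space. -/
def SpinStructure.Section.cov {EF F : Type*} [NormedAddCommGroup EF] [NormedSpace ℝ EF]
    [TopologicalSpace F] [ChartedSpace EF F] {act : Sp1 →* Equiv.Perm F}
    (u : P.Section EF act) (f : Q) (w : E4) : EF :=
  u.dmap f (A.horLift f w)

lemma SpinStructure.pureDirac_eq_zero_iff {EF F : Type*} [NormedAddCommGroup EF] [NormedSpace ℝ EF]
    [TopologicalSpace F] [ChartedSpace EF F] {act : Sp1 →* Equiv.Perm F}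
    (I : Fin 3 → ∀ y : F, TangentSpace 𝓘(ℝ, EF) y →L[ℝ] TangentSpace 𝓘(ℝ, EF) y)
    (v : P.Section EF act) (f : Q) (w : E4) : pureDirac A I v f w = 0 ↔
      v.cov A f w = ∑ l, (I l (v.equivariantMap f) : EF →L[ℝ] EF) (v.cov A f (P.quat f l w)) :=
  P.cliffordPart_eq_zero_iff f _ _ w

variable (u : P.Section EM T.actSp)

/-- The covariant derivative `∇^B u` on the model spaces. -/
def SpinStructure.Section.twistedCov (b : LForm P Γ) (f : Q) (w : E4) : EM := covDeriv A T b u f w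

/-- `∇^B u = ∇^φ u + K_b`: the `B`-horizontal lift to `𝒢 × Q` has the `𝒢`-component `-b`, and the
equivariant map is `(a, f) ↦ a⁻¹ û(f)`. -/
lemma twistedCov_eq [LieGroup 𝓘(ℝ, EG) ∞ G] (b : LForm P Γ) (f : Q) (w : E4) :
    u.twistedCov A b f w =
      u.cov A f w + T.kill (u.equivariantMap f) (b.toFun f (A.horLift f w)) := by
  have hi : ContMDiff 𝓘(ℝ, EG) 𝓘(ℝ, EG) ∞ (fun a : G => a⁻¹) := contMDiff_inv 𝓘(ℝ, EG) ∞
  have hΦ : ContMDiff (𝓘(ℝ, EG).prod 𝓘(ℝ, EQ)) 𝓘(ℝ, EM) ∞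
      (fun p : G × Q => T.actG p.1⁻¹ (u.equivariantMap p.2)) :=
    T.smooth_actG.comp ((hi.comp contMDiff_fst).prodMk
      (u.contMDiff_equivariantMap.comp contMDiff_snd))
  have h := mderiv_prod (Φ := fun (a : G) f => T.actG a⁻¹ (u.equivariantMap f))
    (hΦ.mdifferentiableAt (x := (1, f)) (by simp)) (-b.toFun f (A.horLift f w)) (A.horLift f w)
  rw [T.mderiv_actG_inv, map_neg, neg_neg, add_comm] at h
  refine h.trans ?_
  have h1 : (fun f => T.actG (1 : G)⁻¹ (u.equivariantMap f)) = u.equivariantMap := by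
    funext f; simp
  rw [h1]
  rfl

lemma dirac_eq_zero_iff (b : LForm P Γ) (f : Q) (w : E4) : dirac A T b u f w = 0 ↔
    u.twistedCov A b f w =
      ∑ l, T.hk.cplx (u.equivariantMap f) l (u.twistedCov A b f (P.quat f l w)) :=
  P.cliffordPart_eq_zero_iff f _ _ w

variable {u}

lemma NuVanishes.dμ_dmap (hu : NuVanishes T u) (f : Q) (w : EQ) :
    T.dμ (u.equivariantMap f) (u.dmap f w) = 0 := by
  unfold Target.dμ SpinStructure.Section.dmap
  rw [← mderiv_comp (T.smooth_μ.mdifferentiableAt (by simp))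
    (u.contMDiff_equivariantMap.mdifferentiableAt (by simp)) rfl]
  have h : (fun f => T.μ (u.equivariantMap f)) = fun _ => 0 := funext hu.μ_equivariantMap
  rw [h, mderiv_const]
  rfl

variable (u) in
/-- The component of the covariant derivative `∇^φ u` orthogonal to the `𝒢`-orbits. -/
def SpinStructure.Section.horCov (f : Q) (w : E4) : EM :=
  u.cov A f w - T.kill (u.equivariantMap f) (T.conn (u.equivariantMap f) (u.cov A f w))

/-- The condition that the component of `∇^φ u` orthogonal to the `𝒢`-orbits has vanishing
`ℍ`-linear part. Neither the section of the reduction nor the 1-form `b` enters. -/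
def SpinStructure.Section.IsHorizontallyHarmonic (u : P.Section EM T.actSp) : Prop :=
  ∀ (f : Q) (w : E4), u.horCov A f w =
    ∑ l, T.hk.cplx (u.equivariantMap f) l (u.horCov A f (P.quat f l w))

variable [FiniteDimensional ℝ EG] [LieGroup 𝓘(ℝ, EG) ∞ G]

/-- A solution of the twisted Dirac equation has a covariant derivative without Killing component:
it lies in `ker dμ`, and the Dirac equation exhibits it as a sum of images of such vectors under the
complex structures, which are orthogonal to the `𝒢`-orbits. -/
lemma twistedCov_eq_horCov (hreg : T.ZeroIsRegularValue) (hu : NuVanishes T u) {b : LForm P Γ}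
    {f : Q} {w : E4} (hb : dirac A T b u f w = 0) : u.twistedCov A b f w = u.horCov A f w := by
  have hs : Function.Surjective (T.dμ (u.equivariantMap f)) := hreg _ (hu.μ_equivariantMap f)
  have hd : ∀ w : E4, T.dμ (u.equivariantMap f) (u.twistedCov A b f w) = 0 := fun w => by
    rw [twistedCov_eq, map_add, T.dμ_kill (hu.μ_equivariantMap f), add_zero]
    exact hu.dμ_dmap f _
  have h0 := T.conn_eq_zero_of_eq_sum hs (fun l => hd (P.quat f l w))
    ((dirac_eq_zero_iff A u b f w).1 hb)
  rw [twistedCov_eq] at h0 ⊢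
  rw [map_add, T.conn_kill hs] at h0
  rw [SpinStructure.Section.horCov, eq_neg_of_add_eq_zero_left h0, map_neg, sub_neg_eq_add]

lemma twistedCov_horizontalForm
    (hs : ∀ f, Function.Surjective (T.dμ (u.equivariantMap f))) (f : Q) (w : E4) :
    u.twistedCov A (horizontalForm A u hs) f w = u.horCov A f w := by
  rw [twistedCov_eq]
  change u.cov A f w + T.kill (u.equivariantMap f)
    (-(T.conn (u.equivariantMap f) (u.dmap f (A.hor f (A.horLift f w))))) = _
  rw [A.hor_horLift, map_neg, ← sub_eq_add_neg]
  rfl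

lemma exists_dirac_eq_zero_iff (hreg : T.ZeroIsRegularValue) (hu : NuVanishes T u) :
    (∃ b : LForm P Γ, ∀ f w, dirac A T b u f w = 0) ↔ u.IsHorizontallyHarmonic A := by
  have hs : ∀ f, Function.Surjective (T.dμ (u.equivariantMap f)) :=
    fun f => hreg _ (hu.μ_equivariantMap f)
  constructor
  · rintro ⟨b, hb⟩ f w
    have h := (dirac_eq_zero_iff A u b f w).1 (hb f w)
    rw [twistedCov_eq_horCov A hreg hu (hb f w)] at h
    rw [h]
    exact Finset.sum_congr rfl fun l _ =>
      congrArg _ (twistedCov_eq_horCov A hreg hu (hb f (P.quat f l w)))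
  · intro h
    refine ⟨horizontalForm A u hs, fun f w => (dirac_eq_zero_iff A u _ f w).2 ?_⟩
    rw [twistedCov_horizontalForm A hs f w]
    simp only [twistedCov_horizontalForm]
    exact h f w

variable [FiniteDimensional ℝ EM]
  {EN : Type*} [NormedAddCommGroup EN] [NormedSpace ℝ EN] [ChartedSpace EN T.Level]
  [IsManifold 𝓘(ℝ, EN) ∞ T.Level]
  {E0 : Type*} [NormedAddCommGroup E0] [NormedSpace ℝ E0] [FiniteDimensional ℝ E0]
  [ChartedSpace E0 T.Reduction]

/-- The differential of the projection identifies the vectors orthogonal to the `𝒢`-orbits in the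
zero level with the tangent vectors of the reduction, compatibly with the complex structures; under
this identification the covariant derivative of the projected section is `u.horCov`. -/
lemma pureDirac_redI_eq_zero_iff (hreg : T.ZeroIsRegularValue) (hu : NuVanishes T u)
    (hN : Manifold.IsSmoothEmbedding 𝓘(ℝ, EN) 𝓘(ℝ, EM) ∞ (Subtype.val : T.Level → M))
    (hM₀ : IsPrincipalBundle (EB := E0) (EP := EN) 𝓘(ℝ, EG) T.toReduction T.levelAct)
    {v : P.Section E0 T.redAct} (hv : IsProjection T u v) (f : Q) (w : E4) :
    SpinStructure.pureDirac A (T.redI EN E0) v f w = 0 ↔ u.horCov A f w =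
        ∑ l, T.hk.cplx (u.equivariantMap f) l (u.horCov A f (P.quat f l w)) := by
  set n := hu.levelMap f
  have hs : Function.Surjective (T.dμ n.1) := hreg _ n.2
  have hvf := (isProjection_iff hu v).1 hv
  have hcov : ∀ w : E4, T.dμ n.1 (u.cov A f w) = 0 := fun w => hu.dμ_dmap f _
  have hH : ∀ w : E4, T.IsHorizontal n.1 (u.horCov A f w) :=
    fun w => T.isHorizontal_sub n.2 hs (hcov w)
  have hcx : ∀ (l : Fin 3) (w : E4), T.IsHorizontal n.1 (T.hk.cplx n.1 l (u.horCov A f w)) :=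
    fun l w => Target.IsHorizontal.cplx T (hH w) l
  have he' : ∀ w : E4, ∃ e : EN, T.dval EN n e = u.horCov A f w :=
    fun w => T.exists_dval_eq hN hs (Target.IsHorizontal.dμ_eq_zero T (hH w))
  have hz' : ∀ (l : Fin 3) (w : E4), ∃ e : EN,
      T.dval EN n e = T.hk.cplx n.1 l (u.horCov A f w) :=
    fun l w => T.exists_dval_eq hN hs (Target.IsHorizontal.dμ_eq_zero T (hcx l w))
  -- representatives in the model space of the zero level
  choose e he using he'
  choose z hz using hz'
  -- `∇^φ u` and its horizontal part differ by a Killing vector, which the projection annihilates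
  have hdv : ∀ w : E4, v.cov A f w = T.dred EN E0 n (e w) := by
    intro w
    have h1 : v.equivariantMap = fun f => T.toReduction (hu.levelMap f) := funext hvf
    have h2 : MDifferentiableAt 𝓘(ℝ, EQ) 𝓘(ℝ, EN) hu.levelMap f :=
      (hu.contMDiff_levelMap hN).mdifferentiableAt (by simp)
    unfold SpinStructure.Section.cov SpinStructure.Section.dmap
    rw [h1, mderiv_comp (hM₀.smooth_proj.mdifferentiableAt (by simp)) h2 rfl, ← sub_eq_zero]
    change T.dred EN E0 n _ - _ = _
    rw [← map_sub, T.dred_eq_zero_iff hN hM₀]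
    refine ⟨T.conn n.1 (u.cov A f w), ?_⟩
    have h3 : T.dval EN n (mderiv 𝓘(ℝ, EQ) 𝓘(ℝ, EN) hu.levelMap f (A.horLift f w)) =
        u.cov A f w := by
      unfold Target.dval
      rw [← mderiv_comp (hN.contMDiff.mdifferentiableAt (by simp)) h2 rfl]
      rfl
    rw [map_sub, he, h3]
    exact sub_sub_cancel _ _
  have hI : ∀ (l : Fin 3) (w : E4), (T.redI EN E0 l (v.equivariantMap f) : E0 →L[ℝ] E0)
      (T.dred EN E0 n (e w)) = T.dred EN E0 n (z l w) := fun l w =>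
    T.redI_dred hN hM₀ l n (hvf f).symm ((he w).symm ▸ hH w) (by rw [hz, he])
  have h1 : SpinStructure.pureDirac A (T.redI EN E0) v f w = 0 ↔
      T.dred EN E0 n (e w) = ∑ l, T.dred EN E0 n (z l (P.quat f l w)) := by
    refine (SpinStructure.pureDirac_eq_zero_iff A _ v f w).trans ?_
    rw [hdv]
    exact Eq.congr rfl (Finset.sum_congr rfl fun l _ => by rw [hdv, hI])
  have hz3 : T.dval EN n (∑ l, z l (P.quat f l w)) =
      ∑ l, T.hk.cplx n.1 l (u.horCov A f (P.quat f l w)) := by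
    rw [map_sum]
    exact Finset.sum_congr rfl fun l _ => hz l _
  have hhor : T.IsHorizontal n.1 (T.dval EN n (e w - ∑ l, z l (P.quat f l w))) := by
    rw [map_sub, hz3, he, Fin.sum_univ_three, ← sub_sub, ← sub_sub]
    exact Target.IsHorizontal.sub T (Target.IsHorizontal.sub T (Target.IsHorizontal.sub T (hH w)
      (hcx 0 _)) (hcx 1 _)) (hcx 2 _)
  rw [h1]
  constructor
  · intro h
    have h0 := T.eq_zero_of_dred_eq_zero hN hM₀ hhor (by rw [map_sub, map_sum, h, sub_self])
    rw [← he, sub_eq_zero.1 h0]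
    exact hz3
  · intro h
    have h3 : e w = ∑ l, z l (P.quat f l w) :=
      T.dval_injective hN n (by rw [he, h]; exact hz3.symm)
    rw [h3, map_sum]

lemma pureDirac_eq_zero_iff_isHorizontallyHarmonic (hreg : T.ZeroIsRegularValue)
    (hu : NuVanishes T u)
    (hN : Manifold.IsSmoothEmbedding 𝓘(ℝ, EN) 𝓘(ℝ, EM) ∞ (Subtype.val : T.Level → M))
    (hM₀ : IsPrincipalBundle (EB := E0) (EP := EN) 𝓘(ℝ, EG) T.toReduction T.levelAct)
    {v : P.Section E0 T.redAct} (hv : IsProjection T u v) :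
    (∀ f w, SpinStructure.pureDirac A (T.redI EN E0) v f w = 0) ↔ u.IsHorizontallyHarmonic A :=
  forall₂_congr fun f w => pureDirac_redI_eq_zero_iff A hreg hu hN hM₀ hv f w

end Comparison

end

theorem mainTheorem3
    {X : Type*} [TopologicalSpace X] [T2Space X] [SecondCountableTopology X]
    [ChartedSpace E4 X] [IsManifold 𝓘(ℝ, E4) ∞ X]
    (g : ContMDiffRiemannianMetric 𝓘(ℝ, E4) ∞ E4 (fun x : X => TangentSpace 𝓘(ℝ, E4) x))
    (o : ∀ x : X, Orientation ℝ (TangentSpace 𝓘(ℝ, E4) x) (Fin 4))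
    {EQ : Type*} [NormedAddCommGroup EQ] [NormedSpace ℝ EQ] [FiniteDimensional ℝ EQ]
    {Q : Type*} [TopologicalSpace Q] [ChartedSpace EQ Q] [IsManifold 𝓘(ℝ, EQ) ∞ Q]
    (P : SpinStructure g o EQ Q) (A : P.LeviCivita)
    {EG : Type*} [NormedAddCommGroup EG] [NormedSpace ℝ EG] [FiniteDimensional ℝ EG]
    {G : Type*} [TopologicalSpace G] [T2Space G] [SecondCountableTopology G]
    [ChartedSpace EG G] [Group G] [LieGroup 𝓘(ℝ, EG) ∞ G]
    (Γ : SymmetryData EG G)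
    {EM : Type*} [NormedAddCommGroup EM] [NormedSpace ℝ EM] [FiniteDimensional ℝ EM]
    {M : Type*} [TopologicalSpace M] [T2Space M] [SecondCountableTopology M]
    [ChartedSpace EM M] [IsManifold 𝓘(ℝ, EM) ∞ M]
    (T : Target EM M Γ)
    (hreg : T.ZeroIsRegularValue) (hfree : T.ActsFreely)
    {EN : Type*} [NormedAddCommGroup EN] [NormedSpace ℝ EN] [FiniteDimensional ℝ EN]
    [ChartedSpace EN T.Level] [IsManifold 𝓘(ℝ, EN) ∞ T.Level]
    (hN : Manifold.IsSmoothEmbedding 𝓘(ℝ, EN) 𝓘(ℝ, EM) ∞ (Subtype.val : T.Level → M))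
    {E0 : Type*} [NormedAddCommGroup E0] [NormedSpace ℝ E0] [FiniteDimensional ℝ E0]
    [ChartedSpace E0 T.Reduction] [IsManifold 𝓘(ℝ, E0) ∞ T.Reduction]
    (hM₀ : IsPrincipalBundle (EB := E0) (EP := EN) 𝓘(ℝ, EG) T.toReduction T.levelAct)
    (u : P.Section EM T.actSp) (hu : NuVanishes T u) :
    (∃! v : P.Section E0 T.redAct, IsProjection T u v) ∧
    ∀ v : P.Section E0 T.redAct, IsProjection T u v →
      ((∀ f w, SpinStructure.pureDirac A (T.redI EN E0) v f w = 0) ↔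
        ∃ b : LForm P Γ, ∀ f w, dirac A T b u f w = 0) := by
  refine ⟨existsUnique_isProjection hu hN hM₀, fun v hv => ?_⟩
  exact (pureDirac_eq_zero_iff_isHorizontallyHarmonic A hreg hu hN hM₀ hv).trans
    (exists_dirac_eq_zero_iff A hreg hu).symm
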